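/- Let $d\ge 1$ and let $\Omega\subset\mathbb R^d$ be a bounded Lipschitz domain: a nonempty, bounded, open, connected set such that for each $x\in\partial\Omega$ there are $r>0$, an isometry $T$ of $\mathbb R^d$ and a Lipschitz function $\varphi:\mathbb R^{d-1}\to\mathbb R$ with $T(\Omega)\cap B_r(T(x))=\{\xi=(\xi',\xi_d):\xi_d>\varphi(\xi')\}\cap B_r(T(x))$. Let $\delta_\Omega(x)=\min_{y\in\partial\Omega}|x-y|$. For $t\in(0,1)$ put $\mathcal L_1(t)=\frac1{1-\ln t}$ and $\mathcal L_m(t)=\mathcal L_1(\mathcal L_{m-1}(t))$ for $m\ge2$. For $u\in L^1(\Omega)$ let $$[u]_{BV(\Omega)}=\sup\Big\{\int_\Omega u\,\operatorname{div}\phi\,dx:\ \phi\in C^1_c(\Omega;\mathbb R^d),\ |\phi|\le1\ \text{on}\ \Omega\Big\},\qquad (u)_\Omega=\frac1{|\Omega|}\int_\Omega u\,dx,$$ and let $BV(\Omega)$ be the set of $u\in L^1(\Omega)$ with $[u]_{BV(\Omega)}<\infty$. For $R>0$ with $\delta_\Omega<R$ on $\Omega$, an integer $m\ge1$ and $\beta>0$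 write $$I_m(u)=I_{m,\beta,R}(u)=\int_\Omega\frac{|u(x)-(u)_\Omega|}{\delta_\Omega(x)}\,\mathcal L_1\Big(\frac{\delta_\Omega(x)}R\Big)\cdots\mathcal L_{m-1}\Big(\frac{\delta_\Omega(x)}R\Big)\,\mathcal L_m^{\beta}\Big(\frac{\delta_\Omega(x)}R\Big)\,dx\in[0,\infty],$$ where for $m=1$ the product of the $\mathcal L$'s is $\mathcal L_1^\beta(\delta_\Omega(x)/R)$. (i) For every $\beta>1$ there is a constant $C=C(d,\Omega,\beta)>0$ such that for all $R>0$ with $\delta_\Omega<R$ on $\Omega$, all integers $m\ge1$ and all $u\in BV(\Omega)$, $$I_m(u)\le C\,2^m\,[u]_{BV(\Omega)}.$$ (ii) For every $\beta>1$ there is a constant $C=C(d,\Omega,\beta)>0$ such that for all $R>0$ with $\delta_\Omega<R$ on $\Omega$, all $0<\alpha<\frac12$ and all $u\in BV(\Omega)$, $$\sum_{m=2}^\infty\alpha^m I_m(u)\le C\,\frac{4\alpha^2}{1-2\alpha}\,[u]_{BV(\Omega)}.$$ (iii) The series inequality fails if $\alpha\ge1$ or $0<\beta\le1$: for all $R>0$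 with $\delta_\Omega<R$ on $\Omega$ and all $\alpha,\beta>0$ with $\alpha\ge1$ or $\beta\le1$ there is $u\in BV(\Omega)$ with $\sum_{m=2}^\infty\alpha^m I_m(u)=\infty$, so that no bound of the series by a finite constant times $[u]_{BV(\Omega)}$ is possible. (iv) The inequality for a single $m$ fails if $0<\beta\le1$: for all $R>0$ with $\delta_\Omega<R$ on $\Omega$, all $0<\beta\le1$ and all integers $m\ge1$ there is $u\in BV(\Omega)$ with $I_m(u)=\infty$. -/

import Mathlib

open MeasureTheory
open scoped ENNReal

namespace BVHardy

/-- Bounded Lipschitz domain in `ℝ^d`, `d = n + 1`: a nonempty, open, connected, bounded set which,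
near each boundary point and after an isometry of `ℝ^d`, is the region strictly above the graph of a
Lipschitz function `ℝ^(d-1) → ℝ`.  A point `ξ` is split as `ξ = (ξ', ξ_d)` with `ξ'` its first
`n = d - 1` coordinates and `ξ_d` its last one. -/
structure IsBoundedLipschitzDomain {n : ℕ} (Ω : Set (EuclideanSpace ℝ (Fin (n + 1)))) : Prop where
  isOpen : IsOpen Ω
  isConnected : IsConnected Ω
  isBounded : Bornology.IsBounded Ω
  exists_graph : ∀ x ∈ frontier Ω, ∃ r : ℝ, 0 < r ∧
    ∃ T : EuclideanSpace ℝ (Fin (n + 1)) ≃ᵢ EuclideanSpace ℝ (Fin (n + 1)),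
    ∃ φ : EuclideanSpace ℝ (Fin n) → ℝ, (∃ K : NNReal, LipschitzWith K φ) ∧
      (T '' Ω) ∩ Metric.ball (T x) r =
        {ξ | φ (WithLp.toLp 2 fun i : Fin n => ξ i.castSucc) < ξ (Fin.last n)} ∩
          Metric.ball (T x) r

/-- The distance `δ_Ω(x)` from `x` to the boundary of `Ω`. -/
noncomputable def bdryDist {d : ℕ} (Ω : Set (EuclideanSpace ℝ (Fin d)))
    (x : EuclideanSpace ℝ (Fin d)) : ℝ :=
  Metric.infDist x (frontier Ω)

/-- The iterated logarithmic functions on `(0, 1)`: `𝓛_1(t) = 1 / (1 - ln t)` and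
`𝓛_{m+1}(t) = 𝓛_1(𝓛_m(t))`, started at `𝓛_0(t) = t`. -/
noncomputable def iterLog : ℕ → ℝ → ℝ
  | 0, t => t
  | m + 1, t => 1 / (1 - Real.log (iterLog m t))

/-- The weight `𝓛_1(t) ⋯ 𝓛_{m-1}(t) 𝓛_m(t)^β`; for `m = 1` the product is empty and the weight is
`𝓛_1(t)^β`. -/
noncomputable def logWeight (m : ℕ) (β t : ℝ) : ℝ :=
  (∏ j ∈ Finset.Ico 1 m, iterLog j t) * iterLog m t ^ β

/-- The divergence `∑ i, ∂φ_i/∂x_i` of a vector field on `ℝ^d`. -/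
noncomputable def divergence {d : ℕ}
    (φ : EuclideanSpace ℝ (Fin d) → EuclideanSpace ℝ (Fin d)) (x : EuclideanSpace ℝ (Fin d)) : ℝ :=
  ∑ i : Fin d, (fderiv ℝ φ x (EuclideanSpace.single i 1)) i

/-- The total variation `[u]_{BV(Ω)}`, as an element of `[0, ∞]`: the supremum of `∫_Ω u div φ` over
the `C^1` vector fields `φ` with compact support in `Ω` and `|φ| ≤ 1` on `Ω`.  The field `φ = 0` is
admissible, so that replacing negative values of the integral by `0` does not affect the
supremum. -/
noncomputable def bvSeminorm {d : ℕ} (Ω : Set (EuclideanSpace ℝ (Fin d)))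
    (u : EuclideanSpace ℝ (Fin d) → ℝ) : ℝ≥0∞ :=
  ⨆ (φ : EuclideanSpace ℝ (Fin d) → EuclideanSpace ℝ (Fin d))
    (_ : ContDiff ℝ 1 φ ∧ HasCompactSupport φ ∧ tsupport φ ⊆ Ω ∧ ∀ x ∈ Ω, ‖φ x‖ ≤ 1),
    ENNReal.ofReal (∫ x in Ω, u x * divergence φ x)

/-- `u ∈ BV(Ω)`: `u ∈ L^1(Ω)` and `[u]_{BV(Ω)} < ∞`. -/
def MemBV {d : ℕ} (Ω : Set (EuclideanSpace ℝ (Fin d)))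
    (u : EuclideanSpace ℝ (Fin d) → ℝ) : Prop :=
  IntegrableOn u Ω volume ∧ bvSeminorm Ω u < ∞

/-- The weighted integral
`∫_Ω |u - (u)_Ω| / δ_Ω · 𝓛_1(δ_Ω/R) ⋯ 𝓛_{m-1}(δ_Ω/R) 𝓛_m(δ_Ω/R)^β dx`, as an element of `[0, ∞]`,
where `(u)_Ω` is the average of `u` over `Ω`. -/
noncomputable def hardyIntegral {d : ℕ} (Ω : Set (EuclideanSpace ℝ (Fin d))) (R : ℝ) (m : ℕ) (β : ℝ)
    (u : EuclideanSpace ℝ (Fin d) → ℝ) : ℝ≥0∞ :=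
  ∫⁻ x in Ω, ENNReal.ofReal
    (|u x - ⨍ y in Ω, u y| / bdryDist Ω x * logWeight m β (bdryDist Ω x / R))

end BVHardy

/-!
The weights are exact derivatives: since `𝓛_m'(t) = 𝓛_1(t) ⋯ 𝓛_{m-1}(t) 𝓛_m(t)² / t`, one has
`𝓛_1 ⋯ 𝓛_{m-1} 𝓛_m^β / t = (𝓛_m^{β-1} / (β-1))'`, and for `β = 1` the left-hand side is
`(log 𝓛_m)'`. Hence the integral over `(0, a)` of the weight is at most `1 / (β-1)` for `β > 1`,
uniformly in `m` and in the scale `R` (`lintegral_logWeight_le`), and is infinite for `β ≤ 1`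
(`lintegral_logWeight_eq_top`). The inequalities reduce to the fact that near the boundary
`|u - c| dx`, as a measure in the distance to the boundary, has bounded density.

The only property of functions of bounded variation that the inequalities need is the translation
estimate `lintegral_translate_sub_le`: if the segments `[x, x + v]`, `x ∈ D`, lie in `Ω` and every
line parallel to `v` meets `D` in length at most `c`, then `∫_D |u(x + v) - u(x)| dx ≤ c [u]`. It is
read off from the definition of `[u]` with the vector field that transports a test function along
these segments; no approximation by smooth functions is needed.

* Poincaré inequality (`IsBoundedLipschitzDomain.isPoincareSet`). On a ball, integrate the
  translation estimate over all translations. Chains of balls give compact subsets of the connected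
  set `Ω`, and near the boundary a fixed translation moves `Ω` into such a compact subset.
* Hardy inequality (`IsGraphChart.lintegral_mul_sub_le`). In a boundary chart with height function
  `ρ`, apply the translation estimate to the thin layers `{ρ ∈ O}`, and average over the lengths of
  the translations. As `ρ` is comparable to the distance to the boundary and the `𝓛_j` are
  increasing, `exists_hardyIntegral_le` follows by compactness of the closure of `Ω`, with a
  constant independent of `m`. The factors `2^m` leave room, and the series is geometric.
* Failure (`exists_memBV_le_hardyIntegral`). For a bump function `u` compactly supported in `Ω`,
  `|u - (u)_Ω|` is a positive constant near the boundary, so the weighted integrals dominate the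
  one-dimensional ones. These are infinite for `β ≤ 1`. For `β > 1` they equal
  `𝓛_m^{β-1} / (β-1)` at a fixed point, which stays away from `0` because `𝓛_m(t) ≥ t`, so that the
  series diverges for `α ≥ 1`.
-/

namespace BVHardy

open Set Filter Topology Metric

variable {d : ℕ}

/-! ### The iterated logarithms -/

lemma iterLog_mem_Ioo {t : ℝ} (ht : t ∈ Ioo (0 : ℝ) 1) (m : ℕ) : iterLog m t ∈ Ioo (0 : ℝ) 1 := by
  induction m with
  | zero => exact ht
  | succ m ih =>
    have h1 : Real.log (iterLog m t) < 0 := Real.log_neg ih.1 ih.2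
    simp only [iterLog]
    refine ⟨by apply div_pos <;> linarith, ?_⟩
    rw [div_lt_one] <;> linarith

lemma iterLog_monotoneOn (m : ℕ) : MonotoneOn (iterLog m) (Ioo 0 1) := by
  induction m with
  | zero => intro s _ t _ h; exact h
  | succ m ih =>
    intro s hs t ht h
    have h1 := iterLog_mem_Ioo hs m
    have h2 := iterLog_mem_Ioo ht m
    have h3 : Real.log (iterLog m s) ≤ Real.log (iterLog m t) := Real.log_le_log h1.1 (ih hs ht h)
    have h4 : Real.log (iterLog m t) < 0 := Real.log_neg h2.1 h2.2
    simp only [iterLog]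
    exact one_div_le_one_div_of_le (by linarith) (by linarith)

/-- The iterates increase with their order, towards the fixed point `1` of `𝓛_1`. -/
lemma le_iterLog {t : ℝ} (ht : t ∈ Ioo (0 : ℝ) 1) (m : ℕ) : t ≤ iterLog m t := by
  induction m with
  | zero => exact le_rfl
  | succ m ih =>
    refine ih.trans ?_
    have h1 := iterLog_mem_Ioo ht m
    have h3 : Real.log (iterLog m t) < 0 := Real.log_neg h1.1 h1.2
    have h4 := Real.one_sub_inv_le_log_of_pos h1.1
    simp only [iterLog]
    rw [le_div_iff₀ (by linarith)]
    calc iterLog m t * (1 - Real.log (iterLog m t)) ≤ iterLog m t * (iterLog m t)⁻¹ := by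
          apply mul_le_mul_of_nonneg_left _ h1.1.le; linarith
      _ = 1 := mul_inv_cancel₀ h1.1.ne'

/-- `𝓛_m' = 𝓛_1 ⋯ 𝓛_{m-1} 𝓛_m² / t`, so that the weights are exact derivatives of powers of
`𝓛_m` (or of `log 𝓛_m`). -/
lemma hasDerivAt_iterLog {t : ℝ} (ht : t ∈ Ioo (0 : ℝ) 1) (m : ℕ) :
    HasDerivAt (iterLog (m + 1))
      ((∏ j ∈ Finset.Ico 1 (m + 1), iterLog j t) * iterLog (m + 1) t ^ 2 / t) t := by
  have key : ∀ (k : ℕ) (D : ℝ), HasDerivAt (iterLog k) D t →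
      HasDerivAt (iterLog (k + 1)) (D / iterLog k t * iterLog (k + 1) t ^ 2) t := by
    intro k D hD
    have h1 := iterLog_mem_Ioo ht k
    have h3 : Real.log (iterLog k t) < 0 := Real.log_neg h1.1 h1.2
    have h4 := ((hD.log h1.1.ne').const_sub 1).fun_inv (by linarith)
    have h5 : iterLog (k + 1) = fun y => (1 - Real.log (iterLog k y))⁻¹ := by
      funext y; simp [iterLog]
    rw [h5]
    refine h4.congr_deriv ?_
    rw [neg_neg, inv_pow, div_eq_mul_inv]
  induction m with
  | zero =>
    have := key 0 1 (hasDerivAt_id t)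
    refine this.congr_deriv ?_
    simp [iterLog]; ring
  | succ m ih =>
    refine (key _ _ ih).congr_deriv ?_
    have h1 := (iterLog_mem_Ioo ht (m + 1)).1.ne'
    rw [Finset.prod_Ico_succ_top (show 1 ≤ m + 1 by omega) (fun j => iterLog j t)]
    field_simp

lemma logWeight_nonneg {t : ℝ} (ht : t ∈ Ioo (0 : ℝ) 1) (m : ℕ) (β : ℝ) : 0 ≤ logWeight m β t :=
  mul_nonneg (Finset.prod_nonneg fun j _ => (iterLog_mem_Ioo ht j).1.le)
    (Real.rpow_nonneg (iterLog_mem_Ioo ht m).1.le _)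

lemma logWeight_le_one {t : ℝ} (ht : t ∈ Ioo (0 : ℝ) 1) (m : ℕ) {β : ℝ} (hβ : 0 ≤ β) :
    logWeight m β t ≤ 1 :=
  mul_le_one₀ (Finset.prod_le_one (fun j _ => (iterLog_mem_Ioo ht j).1.le)
      fun j _ => (iterLog_mem_Ioo ht j).2.le)
    (Real.rpow_nonneg (iterLog_mem_Ioo ht m).1.le _)
    (Real.rpow_le_one (iterLog_mem_Ioo ht m).1.le (iterLog_mem_Ioo ht m).2.le hβ)

lemma logWeight_mono {s t : ℝ} (hs : s ∈ Ioo (0 : ℝ) 1) (ht : t ∈ Ioo (0 : ℝ) 1) (hst : s ≤ t)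
    (m : ℕ) {β : ℝ} (hβ : 0 ≤ β) : logWeight m β s ≤ logWeight m β t :=
  mul_le_mul (Finset.prod_le_prod (fun j _ => (iterLog_mem_Ioo hs j).1.le)
      fun j _ => iterLog_monotoneOn j hs ht hst)
    (Real.rpow_le_rpow (iterLog_mem_Ioo hs m).1.le (iterLog_monotoneOn m hs ht hst) hβ)
    (Real.rpow_nonneg (iterLog_mem_Ioo hs m).1.le _)
    (Finset.prod_nonneg fun j _ => (iterLog_mem_Ioo ht j).1.le)

lemma logWeight_anti {t : ℝ} (ht : t ∈ Ioo (0 : ℝ) 1) (m : ℕ) {β γ : ℝ} (h : β ≤ γ) :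
    logWeight m γ t ≤ logWeight m β t :=
  mul_le_mul_of_nonneg_left
    (Real.rpow_le_rpow_of_exponent_ge (iterLog_mem_Ioo ht m).1 (iterLog_mem_Ioo ht m).2.le h)
    (Finset.prod_nonneg fun j _ => (iterLog_mem_Ioo ht j).1.le)

lemma measurable_iterLog (m : ℕ) : Measurable (iterLog m) := by
  induction m with
  | zero => exact measurable_id
  | succ m ih =>
    have : iterLog (m + 1) = fun t => 1 / (1 - Real.log (iterLog m t)) := rfl
    rw [this]
    fun_prop

lemma measurable_logWeight (m : ℕ) (β : ℝ) : Measurable (logWeight m β) := by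
  have := measurable_iterLog
  unfold logWeight
  fun_prop

lemma tendsto_iterLog_zero (m : ℕ) : Tendsto (iterLog m) (𝓝[>] 0) (𝓝[>] 0) := by
  induction m with
  | zero => exact tendsto_id
  | succ m ih =>
    have h1 : Tendsto (fun t => 1 - Real.log (iterLog m t)) (𝓝[>] 0) atTop := by
      have := tendsto_neg_atBot_atTop.comp (Real.tendsto_log_nhdsGT_zero.comp ih)
      simpa [Function.comp_def, sub_eq_add_neg] using tendsto_atTop_add_const_left _ 1 this
    have h2 := tendsto_inv_atTop_nhdsGT_zero.comp h1
    refine h2.congr fun t => ?_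
    simp [iterLog]

/-! ### One-dimensional integrals of the weights -/

lemma div_mem_Ioo_of_lt {t R : ℝ} (h0 : 0 < t) (h : t < R) : t / R ∈ Ioo (0 : ℝ) 1 :=
  ⟨div_pos h0 (h0.trans h), (div_lt_one (h0.trans h)).2 h⟩

lemma hasDerivAt_iterLog_div {t R : ℝ} (h0 : 0 < t) (h : t < R) (m : ℕ) :
    HasDerivAt (fun t => iterLog (m + 1) (t / R))
      ((∏ j ∈ Finset.Ico 1 (m + 1), iterLog j (t / R)) * iterLog (m + 1) (t / R) ^ 2 / t) t := by
  have hR : R ≠ 0 := (h0.trans h).ne'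
  refine (HasDerivAt.comp (h₂ := iterLog (m + 1)) t
    (hasDerivAt_iterLog (div_mem_Ioo_of_lt h0 h) m)
    ((hasDerivAt_id t).div_const R)).congr_deriv ?_
  field_simp

lemma hasDerivAt_iterLog_rpow {t R : ℝ} (h0 : 0 < t) (h : t < R) {m : ℕ} (hm : 1 ≤ m) {β : ℝ}
    (hβ : 1 < β) :
    HasDerivAt (fun t => iterLog m (t / R) ^ (β - 1) / (β - 1)) (logWeight m β (t / R) / t) t := by
  obtain ⟨m, rfl⟩ := Nat.exists_eq_add_of_le' hm
  have hm' := div_mem_Ioo_of_lt h0 h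
  have hL := (iterLog_mem_Ioo hm' (m + 1)).1
  have h1 := hasDerivAt_iterLog_div h0 h m
  have h2 := (h1.rpow_const (p := β - 1) (Or.inl hL.ne')).div_const (β - 1)
  refine h2.congr_deriv ?_
  have hR : R ≠ 0 := (h0.trans h).ne'
  have hβ' : β - 1 ≠ 0 := by linarith
  have e : iterLog (m + 1) (t / R) ^ β
      = iterLog (m + 1) (t / R) ^ (β - 1 - 1) * iterLog (m + 1) (t / R) ^ 2 := by
    rw [← Real.rpow_natCast, ← Real.rpow_add hL]; congr 1; push_cast; ring
  simp only [logWeight]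
  rw [e]
  field_simp

lemma hasDerivAt_log_iterLog {t R : ℝ} (h0 : 0 < t) (h : t < R) {m : ℕ} (hm : 1 ≤ m) :
    HasDerivAt (fun t => Real.log (iterLog m (t / R))) (logWeight m 1 (t / R) / t) t := by
  obtain ⟨m, rfl⟩ := Nat.exists_eq_add_of_le' hm
  have hm' := div_mem_Ioo_of_lt h0 h
  have hL := (iterLog_mem_Ioo hm' (m + 1)).1
  have h1 := hasDerivAt_iterLog_div h0 h m
  refine (h1.log hL.ne').congr_deriv ?_
  have hR : R ≠ 0 := (h0.trans h).ne'
  simp only [logWeight, Real.rpow_one]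
  field_simp

lemma continuousOn_logWeight_div (m : ℕ) (β R : ℝ) :
    ContinuousOn (fun t => logWeight m β (t / R) / t) (Ioo 0 R) := by
  have hc : ∀ m, ContinuousOn (fun t => iterLog m (t / R)) (Ioo 0 R) := by
    intro m t ht
    cases m with
    | zero => exact (continuous_id.div_const R).continuousWithinAt
    | succ m =>
      exact (hasDerivAt_iterLog_div ht.1 ht.2 m).continuousAt.continuousWithinAt
  refine ContinuousOn.div ?_ continuousOn_id fun t ht => ht.1.ne'
  refine ContinuousOn.mul (continuousOn_finsetProd _ fun j _ => hc j) ?_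
  exact (hc m).rpow_const fun t ht =>
    Or.inl (iterLog_mem_Ioo (div_mem_Ioo_of_lt ht.1 ht.2) m).1.ne'

/-- The fundamental theorem of calculus for a nonnegative integrand on an interval that is open at
its left end, where the integral may be improper. -/
lemma tendsto_lintegral_Ioc_of_hasDerivAt {F f : ℝ → ℝ} {a : ℝ} (ha : 0 < a)
    (hF : ∀ t ∈ Ioc 0 a, HasDerivAt F (f t) t) (hf : ContinuousOn f (Ioc 0 a))
    (hpos : ∀ t ∈ Ioc 0 a, 0 ≤ f t) :
    Tendsto (fun ε => ENNReal.ofReal (F a - F ε)) (𝓝[>] 0)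
      (𝓝 (∫⁻ t in Ioc 0 a, ENNReal.ofReal (f t))) := by
  have hcov : AECover (volume.restrict (Ioc (0 : ℝ) a)) (𝓝[>] (0 : ℝ)) (fun ε => Ioc ε a) :=
    { ae_eventually_mem := by
        filter_upwards [ae_restrict_mem measurableSet_Ioc] with x hx
        filter_upwards [Ioo_mem_nhdsGT hx.1] with ε hε
        exact ⟨hε.2, hx.2⟩
      measurableSet := fun _ => measurableSet_Ioc }
  have hm : AEMeasurable (fun t => ENNReal.ofReal (f t)) (volume.restrict (Ioc (0 : ℝ) a)) :=
    (hf.aemeasurable measurableSet_Ioc).ennreal_ofReal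
  refine (hcov.lintegral_tendsto_of_countably_generated hm).congr' ?_
  filter_upwards [Ioo_mem_nhdsGT ha] with ε hε
  have hsub : Icc ε a ⊆ Ioc 0 a := fun x hx => ⟨hε.1.trans_le hx.1, hx.2⟩
  have hint : IntervalIntegrable f volume ε a :=
    (hf.mono (by rwa [uIcc_of_le hε.2.le])).intervalIntegrable
  rw [Measure.restrict_restrict measurableSet_Ioc,
    inter_eq_self_of_subset_left (Ioc_subset_Icc_self.trans hsub),
    ← ofReal_integral_eq_lintegral_ofReal]
  · rw [← intervalIntegral.integral_of_le hε.2.le,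
      intervalIntegral.integral_eq_sub_of_hasDerivAt _ hint]
    intro x hx
    rw [uIcc_of_le hε.2.le] at hx
    exact hF x (hsub hx)
  · exact hint.1
  · filter_upwards [ae_restrict_mem measurableSet_Ioc] with x hx
    exact hpos x (hsub (Ioc_subset_Icc_self hx))

lemma logWeight_div_nonneg {t R : ℝ} (h0 : 0 < t) (h : t < R) (m : ℕ) (β : ℝ) :
    0 ≤ logWeight m β (t / R) / t :=
  div_nonneg (logWeight_nonneg (div_mem_Ioo_of_lt h0 h) _ _) h0.le

lemma lintegral_logWeight_eq {a R : ℝ} (ha : 0 < a) (haR : a < R) {m : ℕ} (hm : 1 ≤ m) {β : ℝ}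
    (hβ : 1 < β) :
    ∫⁻ t in Ioc 0 a, ENNReal.ofReal (logWeight m β (t / R) / t)
      = ENNReal.ofReal (iterLog m (a / R) ^ (β - 1) / (β - 1)) := by
  have hR : 0 < R := ha.trans haR
  have h1 := tendsto_lintegral_Ioc_of_hasDerivAt ha
    (fun t ht => hasDerivAt_iterLog_rpow ht.1 (ht.2.trans_lt haR) hm hβ)
    ((continuousOn_logWeight_div m β R).mono fun t ht => ⟨ht.1, ht.2.trans_lt haR⟩)
    (fun t ht => logWeight_div_nonneg ht.1 (ht.2.trans_lt haR) m β)
  refine tendsto_nhds_unique h1 ?_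
  have h2 : Tendsto (fun ε : ℝ => iterLog m (ε / R)) (𝓝[>] 0) (𝓝 0) := by
    refine (tendsto_iterLog_zero m).mono_right nhdsWithin_le_nhds |>.comp ?_
    refine tendsto_nhdsWithin_iff.2 ⟨?_, ?_⟩
    · have : Tendsto (fun ε : ℝ => ε / R) (𝓝 0) (𝓝 (0 / R)) := tendsto_id.div_const R
      rw [zero_div] at this
      exact this.mono_left nhdsWithin_le_nhds
    · filter_upwards [self_mem_nhdsWithin] with ε hε using div_pos hε hR
  have h3 := (h2.rpow_const (p := β - 1) (Or.inr (by linarith))).div_const (β - 1)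
  rw [Real.zero_rpow (by linarith), zero_div] at h3
  simpa using ENNReal.tendsto_ofReal (h3.const_sub (iterLog m (a / R) ^ (β - 1) / (β - 1)))

/-- For `β > 1` the integral of the weight is bounded uniformly in the order `m` and in `R`. -/
lemma lintegral_logWeight_le {a R : ℝ} (ha : 0 < a) (haR : a < R) {m : ℕ} (hm : 1 ≤ m) {β : ℝ}
    (hβ : 1 < β) :
    ∫⁻ t in Ioc 0 a, ENNReal.ofReal (logWeight m β (t / R) / t) ≤ ENNReal.ofReal (1 / (β - 1)) := by
  rw [lintegral_logWeight_eq ha haR hm hβ]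
  have := iterLog_mem_Ioo (div_mem_Ioo_of_lt ha haR) m
  refine ENNReal.ofReal_le_ofReal (div_le_div_of_nonneg_right ?_ (by linarith))
  exact Real.rpow_le_one this.1.le this.2.le (by linarith)

lemma lintegral_logWeight_eq_top {a R : ℝ} (ha : 0 < a) (haR : a < R) {m : ℕ} (hm : 1 ≤ m) {β : ℝ}
    (hβ : β ≤ 1) :
    ∫⁻ t in Ioc 0 a, ENNReal.ofReal (logWeight m β (t / R) / t) = ∞ := by
  have hR : 0 < R := ha.trans haR
  have h1 := tendsto_lintegral_Ioc_of_hasDerivAt ha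
    (fun t ht => hasDerivAt_log_iterLog ht.1 (ht.2.trans_lt haR) hm)
    ((continuousOn_logWeight_div m 1 R).mono fun t ht => ⟨ht.1, ht.2.trans_lt haR⟩)
    (fun t ht => logWeight_div_nonneg ht.1 (ht.2.trans_lt haR) m 1)
  have h2 : Tendsto (fun ε : ℝ => Real.log (iterLog m (ε / R))) (𝓝[>] 0) atBot := by
    refine Real.tendsto_log_nhdsGT_zero.comp ((tendsto_iterLog_zero m).comp ?_)
    refine tendsto_nhdsWithin_iff.2 ⟨?_, ?_⟩
    · have : Tendsto (fun ε : ℝ => ε / R) (𝓝 0) (𝓝 (0 / R)) := tendsto_id.div_const R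
      rw [zero_div] at this
      exact this.mono_left nhdsWithin_le_nhds
    · filter_upwards [self_mem_nhdsWithin] with ε hε using div_pos hε hR
  have h3 : Tendsto (fun ε => Real.log (iterLog m (a / R)) - Real.log (iterLog m (ε / R)))
      (𝓝[>] 0) atTop := by
    simpa [sub_eq_add_neg] using
      tendsto_atTop_add_const_left _ (Real.log (iterLog m (a / R))) (tendsto_neg_atBot_atTop.comp h2)
  have h4 := tendsto_nhds_unique h1 (ENNReal.tendsto_ofReal_atTop.comp h3)
  rw [eq_top_iff, ← h4]
  refine setLIntegral_mono' measurableSet_Ioc fun t ht => ENNReal.ofReal_le_ofReal ?_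
  exact div_le_div_of_nonneg_right
    (logWeight_anti (div_mem_Ioo_of_lt ht.1 (ht.2.trans_lt haR)) m hβ) ht.1.le

/-- The integral of the weight stays away from `0` as the order `m` grows. -/
lemma exists_le_lintegral_logWeight {a R : ℝ} (ha : 0 < a) (haR : a < R) (β : ℝ) :
    ∃ c : ℝ≥0∞, c ≠ 0 ∧ ∀ m : ℕ, 1 ≤ m →
      c ≤ ∫⁻ t in Ioc 0 a, ENNReal.ofReal (logWeight m β (t / R) / t) := by
  rcases le_or_gt β 1 with hβ | hβ
  · exact ⟨1, one_ne_zero, fun m hm => by rw [lintegral_logWeight_eq_top ha haR hm hβ]; exact le_top⟩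
  · have h0 := div_mem_Ioo_of_lt ha haR
    refine ⟨ENNReal.ofReal ((a / R) ^ (β - 1) / (β - 1)), ?_, fun m hm => ?_⟩
    · rw [Ne, ENNReal.ofReal_eq_zero, not_le]
      exact div_pos (Real.rpow_pos_of_pos h0.1 _) (by linarith)
    · rw [lintegral_logWeight_eq ha haR hm hβ]
      refine ENNReal.ofReal_le_ofReal (div_le_div_of_nonneg_right ?_ (by linarith))
      exact Real.rpow_le_rpow h0.1.le (le_iterLog h0 m) (by linarith)

/-! ### Duality for the `L¹` norm -/

lemma exists_contDiff_eq_one_of_isCompact {K U : Set (EuclideanSpace ℝ (Fin d))} (hK : IsCompact K)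
    (hU : IsOpen U) (hKU : K ⊆ U) :
    ∃ χ : EuclideanSpace ℝ (Fin d) → ℝ, ContDiff ℝ 1 χ ∧ HasCompactSupport χ ∧ tsupport χ ⊆ U ∧
      (∀ x ∈ K, χ x = 1) ∧ ∀ x, χ x ∈ Icc (0 : ℝ) 1 := by
  obtain ⟨L, hL, hKL, hLU⟩ := exists_compact_between hK hU hKU
  obtain ⟨f, h1, h0, h01⟩ := exists_contMDiffMap_one_nhds_of_subset_interior (n := 1)
    (modelWithCornersSelf ℝ (EuclideanSpace ℝ (Fin d))) hK.isClosed hKL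
  have hs : tsupport f ⊆ L := closure_minimal (fun x hx => by
    by_contra h
    exact hx (h0 x h)) hL.isClosed
  exact ⟨f, f.contMDiff.contDiff, hL.of_isClosed_subset (isClosed_tsupport _) hs, hs.trans hLU,
    fun x hx => h1.self_of_nhdsSet x hx, h01⟩

/-- The `L¹` norm on an open set is the supremum of the pairings with `C¹` test functions: the sign
of `f` is approximated by a difference of two cut-off functions. -/
lemma lintegral_enorm_le_of_forall_test {f : EuclideanSpace ℝ (Fin d) → ℝ} (hf : Integrable f)
    (hfm : Measurable f) {D : Set (EuclideanSpace ℝ (Fin d))} (hD : IsOpen D) {M : ℝ}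
    (h : ∀ ψ : EuclideanSpace ℝ (Fin d) → ℝ, ContDiff ℝ 1 ψ → HasCompactSupport ψ →
      tsupport ψ ⊆ D → (∀ x, |ψ x| ≤ 1) → ∫ x, f x * ψ x ≤ M) :
    ∫⁻ x in D, ‖f x‖ₑ ≤ ENNReal.ofReal M := by
  have hfin : IsFiniteMeasure (volume.withDensity fun x => ‖f x‖ₑ) :=
    isFiniteMeasure_withDensity hf.2.ne
  set μ := volume.withDensity fun x => ‖f x‖ₑ
  have hP : MeasurableSet (D ∩ {x | 0 < f x}) :=
    hD.measurableSet.inter (measurableSet_lt measurable_const hfm)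
  have hN : MeasurableSet (D ∩ {x | f x < 0}) :=
    hD.measurableSet.inter (measurableSet_lt hfm measurable_const)
  rw [← ofReal_integral_norm_eq_lintegral_enorm hf.integrableOn]
  refine ENNReal.ofReal_le_ofReal (le_of_forall_pos_le_add fun ε hε => ?_)
  have hε4 : ENNReal.ofReal (ε / 4) ≠ 0 := by simpa using by positivity
  obtain ⟨K₁, hK₁P, hK₁, hμ₁⟩ := hP.exists_isCompact_sdiff_lt (measure_ne_top μ _) hε4
  obtain ⟨K₂, hK₂N, hK₂, hμ₂⟩ := hN.exists_isCompact_sdiff_lt (measure_ne_top μ _) hε4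
  have hdisj : ∀ x ∈ K₁, x ∉ K₂ := fun x h1 h2 =>
    lt_asymm (show 0 < f x from (hK₁P h1).2) (hK₂N h2).2
  obtain ⟨χ₁, hc₁, hs₁, hD₁, h1₁, h01₁⟩ := exists_contDiff_eq_one_of_isCompact hK₁
    (hD.sdiff hK₂.isClosed) fun x hx => ⟨(hK₁P hx).1, hdisj x hx⟩
  obtain ⟨χ₂, hc₂, hs₂, hD₂, h1₂, h01₂⟩ := exists_contDiff_eq_one_of_isCompact hK₂
    (hD.sdiff hK₁.isClosed) fun x hx => ⟨(hK₂N hx).1, fun h' => hdisj x h' hx⟩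
  have hb : ∀ x, |χ₁ x - χ₂ x| ≤ 1 := fun x => by
    have := h01₁ x; have := h01₂ x
    simp only [mem_Icc] at *
    rw [abs_le]; constructor <;> linarith
  have hts : tsupport (fun x => χ₁ x - χ₂ x) ⊆ D := by
    refine (tsupport_sub χ₁ χ₂).trans (union_subset ?_ ?_)
    · exact hD₁.trans sdiff_subset
    · exact hD₂.trans sdiff_subset
  have hmain := h (fun x => χ₁ x - χ₂ x) (hc₁.sub hc₂) (hs₁.sub hs₂) hts hb
  set J := (D ∩ {x | 0 < f x}) \ K₁ ∪ (D ∩ {x | f x < 0}) \ K₂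
  have hJ : MeasurableSet J := (hP.diff hK₁.measurableSet).union (hN.diff hK₂.measurableSet)
  have hJε : ∫ x in J, ‖f x‖ ≤ ε / 2 := by
    rw [integral_norm_eq_lintegral_enorm hfm.aestronglyMeasurable, ← withDensity_apply _ hJ]
    refine ENNReal.toReal_le_of_le_ofReal (by positivity) ((measure_union_le _ _).trans ?_)
    refine (add_le_add hμ₁.le hμ₂.le).trans ?_
    rw [← ENNReal.ofReal_add (by positivity) (by positivity)]
    exact ENNReal.ofReal_le_ofReal (by linarith)
  -- `ψ = χ₁ - χ₂` agrees with the sign of `f` on `D`, except on `J`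
  have hpt : ∀ x, D.indicator (fun x => ‖f x‖) x
      ≤ f x * (χ₁ x - χ₂ x) + 2 * J.indicator (fun x => ‖f x‖) x := by
    intro x
    have hlow : -‖f x‖ ≤ f x * (χ₁ x - χ₂ x) := by
      refine (neg_le_neg ?_).trans (neg_abs_le _)
      rw [abs_mul, Real.norm_eq_abs]
      exact mul_le_of_le_one_right (abs_nonneg _) (hb x)
    by_cases hxJ : x ∈ J
    · rw [indicator_of_mem hxJ]
      have := indicator_le_self' (s := D) (f := fun x => ‖f x‖) (fun x _ => norm_nonneg (f x)) x
      linarith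
    rw [indicator_of_notMem hxJ, mul_zero, add_zero]
    by_cases hxD : x ∈ D
    · rw [indicator_of_mem hxD]
      have hx1 : 0 < f x → x ∈ K₁ := fun h0 => by
        by_contra hn; exact hxJ (Or.inl ⟨⟨hxD, h0⟩, hn⟩)
      have hx2 : f x < 0 → x ∈ K₂ := fun h0 => by
        by_contra hn; exact hxJ (Or.inr ⟨⟨hxD, h0⟩, hn⟩)
      rcases lt_trichotomy (f x) 0 with h0 | h0 | h0
      · have h3 : χ₁ x = 0 := image_eq_zero_of_notMem_tsupport fun h' => (hD₁ h').2 (hx2 h0)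
        rw [h3, h1₂ x (hx2 h0), Real.norm_of_nonpos h0.le]; linarith
      · simp [h0]
      · have h3 : χ₂ x = 0 := image_eq_zero_of_notMem_tsupport fun h' => (hD₂ h').2 (hx1 h0)
        rw [h3, h1₁ x (hx1 h0), Real.norm_of_nonneg h0.le]; linarith
    · rw [indicator_of_notMem hxD]
      have h3 : χ₁ x - χ₂ x = 0 :=
        image_eq_zero_of_notMem_tsupport (f := fun x => χ₁ x - χ₂ x) fun h' => hxD (hts h')
      rw [h3, mul_zero]
  have hi1 : Integrable fun x => f x * (χ₁ x - χ₂ x) :=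
    hf.mul_bdd (c := 1) (hc₁.sub hc₂).continuous.aestronglyMeasurable
      (Eventually.of_forall fun x => by simpa using hb x)
  have hi2 : Integrable (J.indicator fun x => ‖f x‖) := hf.norm.indicator hJ
  calc ∫ x in D, ‖f x‖ = ∫ x, D.indicator (fun x => ‖f x‖) x :=
        (integral_indicator hD.measurableSet).symm
    _ ≤ ∫ x, (f x * (χ₁ x - χ₂ x) + 2 * J.indicator (fun x => ‖f x‖) x) :=
        integral_mono (hf.norm.indicator hD.measurableSet) (hi1.add (hi2.const_mul 2)) hpt
    _ = (∫ x, f x * (χ₁ x - χ₂ x)) + 2 * ∫ x in J, ‖f x‖ := by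
        rw [integral_add hi1 (hi2.const_mul 2), integral_const_mul, integral_indicator hJ]
    _ ≤ M + ε := by linarith

/-! ### Vector fields transporting a test function along a segment -/

/-- The average of `ψ` over the segment from `y` back to `y - v`. -/
noncomputable def segmentAverage (v : EuclideanSpace ℝ (Fin d))
    (ψ : EuclideanSpace ℝ (Fin d) → ℝ) (y : EuclideanSpace ℝ (Fin d)) : ℝ :=
  ∫ s in (0 : ℝ)..1, ψ (y - s • v)

lemma hasFDerivAt_segmentAverage {v : EuclideanSpace ℝ (Fin d)}
    {ψ : EuclideanSpace ℝ (Fin d) → ℝ} (hψ : ContDiff ℝ 1 ψ) (hc : HasCompactSupport ψ)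
    (y : EuclideanSpace ℝ (Fin d)) :
    HasFDerivAt (segmentAverage v ψ) (∫ s in (0 : ℝ)..1, fderiv ℝ ψ (y - s • v)) y := by
  have hd : Continuous (fderiv ℝ ψ) := hψ.continuous_fderiv one_ne_zero
  have hψc := hψ.continuous
  obtain ⟨B, hB⟩ := (hc.fderiv ℝ).exists_bound_of_continuous hd
  unfold segmentAverage
  refine (intervalIntegral.hasFDerivAt_integral_of_dominated_of_fderiv_le (s := univ)
    (bound := fun _ => B) (F := fun y s => ψ (y - s • v))
    (F' := fun y s => fderiv ℝ ψ (y - s • v)) univ_mem ?_ ?_ ?_ ?_ ?_ ?_)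
  · exact Eventually.of_forall fun x => Continuous.aestronglyMeasurable (by fun_prop)
  · exact Continuous.intervalIntegrable (by fun_prop) _ _
  · exact Continuous.aestronglyMeasurable (by fun_prop)
  · exact Eventually.of_forall fun s _ x _ => hB _
  · exact intervalIntegrable_const
  · refine Eventually.of_forall fun s _ x _ => ?_
    have h1 : HasFDerivAt ψ (fderiv ℝ ψ (x - s • v)) (x - s • v) :=
      (hψ.differentiable one_ne_zero _).hasFDerivAt
    exact h1.comp x ((hasFDerivAt_id x).sub_const (s • v))

lemma contDiff_segmentAverage {v : EuclideanSpace ℝ (Fin d)}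
    {ψ : EuclideanSpace ℝ (Fin d) → ℝ} (hψ : ContDiff ℝ 1 ψ) (hc : HasCompactSupport ψ) :
    ContDiff ℝ 1 (segmentAverage v ψ) := by
  have hd : Continuous (fderiv ℝ ψ) := hψ.continuous_fderiv one_ne_zero
  rw [contDiff_one_iff_fderiv]
  refine ⟨fun y => (hasFDerivAt_segmentAverage hψ hc y).differentiableAt, ?_⟩
  have h : fderiv ℝ (segmentAverage v ψ) = fun y => ∫ s in (0 : ℝ)..1, fderiv ℝ ψ (y - s • v) :=
    funext fun y => (hasFDerivAt_segmentAverage hψ hc y).fderiv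
  rw [h]
  refine intervalIntegral.continuous_parametric_intervalIntegral_of_continuous' ?_ _ _
  simp only [Function.uncurry_def]
  fun_prop

lemma fderiv_segmentAverage_apply {v : EuclideanSpace ℝ (Fin d)}
    {ψ : EuclideanSpace ℝ (Fin d) → ℝ} (hψ : ContDiff ℝ 1 ψ) (hc : HasCompactSupport ψ)
    (y : EuclideanSpace ℝ (Fin d)) :
    fderiv ℝ (segmentAverage v ψ) y v = ψ y - ψ (y - v) := by
  have hd : Continuous (fderiv ℝ ψ) := hψ.continuous_fderiv one_ne_zero
  rw [(hasFDerivAt_segmentAverage hψ hc y).fderiv, ContinuousLinearMap.intervalIntegral_apply]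
  · have hderiv : ∀ s ∈ uIcc (0 : ℝ) 1,
        HasDerivAt (fun s : ℝ => -ψ (y - s • v)) (fderiv ℝ ψ (y - s • v) v) s := by
      intro s _
      have h1 : HasFDerivAt ψ (fderiv ℝ ψ (y - s • v)) (y - s • v) :=
        (hψ.differentiable one_ne_zero _).hasFDerivAt
      have h2 : HasDerivAt (fun s : ℝ => y - s • v) (-((1 : ℝ) • v)) s :=
        ((hasDerivAt_id s).smul_const v).const_sub y
      have h3 : HasDerivAt (fun s : ℝ => -ψ (y - s • v)) _ s := (h1.comp_hasDerivAt s h2).neg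
      exact h3.congr_deriv (by simp)
    rw [intervalIntegral.integral_eq_sub_of_hasDerivAt hderiv
      (Continuous.intervalIntegrable (by fun_prop) _ _)]
    simp; ring
  · exact Continuous.intervalIntegrable (by fun_prop) _ _

lemma abs_segmentAverage_le {v y : EuclideanSpace ℝ (Fin d)} {ψ : EuclideanSpace ℝ (Fin d) → ℝ}
    {D : Set (EuclideanSpace ℝ (Fin d))} (hD : IsOpen D) (hs : tsupport ψ ⊆ D)
    (hb : ∀ x, |ψ x| ≤ 1) :
    |segmentAverage v ψ y| ≤ (volume {s : ℝ | s ∈ Icc (0 : ℝ) 1 ∧ y - s • v ∈ D}).toReal := by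
  have hm : MeasurableSet {s : ℝ | s ∈ Icc (0 : ℝ) 1 ∧ y - s • v ∈ D} :=
    measurableSet_Icc.inter
      (hD.preimage (by fun_prop : Continuous fun s : ℝ => y - s • v)).measurableSet
  have hfin : volume {s : ℝ | s ∈ Icc (0 : ℝ) 1 ∧ y - s • v ∈ D} ≠ ∞ :=
    ((measure_mono fun s hs => hs.1).trans_lt (by simp : volume (Icc (0 : ℝ) 1) < ∞)).ne
  have h1 : segmentAverage v ψ y
      = ∫ s in {s : ℝ | s ∈ Icc (0 : ℝ) 1 ∧ y - s • v ∈ D}, ψ (y - s • v) := by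
    rw [segmentAverage, intervalIntegral.integral_of_le zero_le_one, ← integral_Icc_eq_integral_Ioc]
    refine setIntegral_eq_of_subset_of_forall_sdiff_eq_zero measurableSet_Icc (fun s hs => hs.1) ?_
    intro s hs'
    exact image_eq_zero_of_notMem_tsupport fun h' => hs'.2 ⟨hs'.1, hs h'⟩
  rw [h1]
  simpa [Measure.real] using norm_setIntegral_le_of_norm_le_const (f := fun s : ℝ => ψ (y - s • v))
    (C := 1) hfin.lt_top fun s _ => by simpa using hb (y - s • v)

lemma divergence_smul_const {g : EuclideanSpace ℝ (Fin d) → ℝ} {y : EuclideanSpace ℝ (Fin d)}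
    (hg : DifferentiableAt ℝ g y) (w : EuclideanSpace ℝ (Fin d)) :
    divergence (fun y => g y • w) y = fderiv ℝ g y w := by
  unfold divergence
  have h : fderiv ℝ (fun y => g y • w) y = (fderiv ℝ g y).smulRight w :=
    (hg.hasFDerivAt.smul_const w).fderiv
  rw [h]
  have hw : w = ∑ i, w i • EuclideanSpace.single i (1 : ℝ) := by
    ext j
    simp [Pi.single_apply]
  conv_rhs => rw [hw, map_sum]
  simp [mul_comm]

/-! ### The translation estimate -/

/-- The translation estimate for functions of bounded variation. If every line parallel to `v`
meets `D` only in a short set, then the bound improves on `‖v‖ * [u]`: the vector field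
transporting a test function supported in `D` along the segments `[x, x + v]` is bounded by the
length of the part of such a line inside `D`. -/
theorem lintegral_translate_sub_le {Ω : Set (EuclideanSpace ℝ (Fin d))}
    {u : EuclideanSpace ℝ (Fin d) → ℝ} (hu : Measurable u) (hui : Integrable u)
    {v : EuclideanSpace ℝ (Fin d)} {D : Set (EuclideanSpace ℝ (Fin d))} (hD : IsOpen D)
    (hseg : ∀ x ∈ D, ∀ s ∈ Icc (0 : ℝ) 1, x + s • v ∈ Ω) {c : ℝ} (hc : 0 < c)
    (hth : ∀ y, volume {s : ℝ | s ∈ Icc (0 : ℝ) 1 ∧ y - s • v ∈ D} * ENNReal.ofReal ‖v‖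
      ≤ ENNReal.ofReal c) :
    ∫⁻ x in D, ‖u (x + v) - u x‖ₑ ≤ ENNReal.ofReal c * bvSeminorm Ω u := by
  rcases eq_or_ne (bvSeminorm Ω u) ∞ with htop | htop
  · rw [htop, ENNReal.mul_top (by simpa using hc)]; exact le_top
  have hu' : Integrable fun x => u (x + v) := hui.comp_add_right v
  rw [← ENNReal.ofReal_toReal htop, ← ENNReal.ofReal_mul hc.le]
  refine lintegral_enorm_le_of_forall_test (hu'.sub hui) (by fun_prop) hD fun ψ hψ hψc hψD hψ1 => ?_
  set w : EuclideanSpace ℝ (Fin d) := -(c⁻¹ • v)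
  set Φ : EuclideanSpace ℝ (Fin d) → EuclideanSpace ℝ (Fin d) := fun y => segmentAverage v ψ y • w
  have hψ0 : ∀ x, x ∉ D → ψ x = 0 := fun x hx =>
    image_eq_zero_of_notMem_tsupport fun h' => hx (hψD h')
  have hdiv : ∀ y, divergence Φ y = c⁻¹ * (ψ (y - v) - ψ y) := by
    intro y
    rw [divergence_smul_const ((contDiff_segmentAverage hψ hψc).differentiable one_ne_zero y),
      map_neg, map_smul, fderiv_segmentAverage_apply hψ hψc, smul_eq_mul]
    ring
  set C : Set (EuclideanSpace ℝ (Fin d)) :=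
    (fun p : EuclideanSpace ℝ (Fin d) × ℝ => p.1 + p.2 • v) '' (tsupport ψ ×ˢ Icc (0 : ℝ) 1)
  have hC : IsCompact C := (hψc.isCompact.prod isCompact_Icc).image (by fun_prop)
  have hCΩ : C ⊆ Ω := by
    rintro _ ⟨⟨x, s⟩, ⟨hx, hs⟩, rfl⟩
    exact hseg x (hψD hx) s hs
  have hΦC : ∀ y, y ∉ C → Φ y = 0 := by
    intro y hy
    have h0 : segmentAverage v ψ y = 0 := by
      refine (intervalIntegral.integral_congr (g := fun _ => (0 : ℝ)) fun s hs => ?_).trans (by simp)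
      rw [uIcc_of_le zero_le_one] at hs
      refine image_eq_zero_of_notMem_tsupport fun h' => hy ⟨(y - s • v, s), ⟨h', hs⟩, ?_⟩
      simp
    simp [Φ, h0]
  have hts : tsupport Φ ⊆ C :=
    closure_minimal (fun y hy => by_contra fun h' => hy (hΦC y h')) hC.isClosed
  have hΦ1 : ∀ y, ‖Φ y‖ ≤ 1 := by
    intro y
    have h1 := abs_segmentAverage_le (v := v) (y := y) hD hψD hψ1
    have h2 := ENNReal.toReal_mono ENNReal.ofReal_ne_top (hth y)
    rw [ENNReal.toReal_mul, ENNReal.toReal_ofReal (norm_nonneg v), ENNReal.toReal_ofReal hc.le] at h2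
    rw [norm_smul, norm_neg, norm_smul, norm_inv, Real.norm_of_nonneg hc.le, Real.norm_eq_abs]
    calc |segmentAverage v ψ y| * (c⁻¹ * ‖v‖) = c⁻¹ * (|segmentAverage v ψ y| * ‖v‖) := by ring
      _ ≤ c⁻¹ * c := by gcongr; exact (mul_le_mul_of_nonneg_right h1 (norm_nonneg v)).trans h2
      _ = 1 := inv_mul_cancel₀ hc.ne'
  have hle : ENNReal.ofReal (∫ x in Ω, u x * divergence Φ x) ≤ bvSeminorm Ω u :=
    le_iSup₂_of_le (f := fun (φ : EuclideanSpace ℝ (Fin d) → EuclideanSpace ℝ (Fin d))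
      (_ : ContDiff ℝ 1 φ ∧ HasCompactSupport φ ∧ tsupport φ ⊆ Ω ∧ ∀ x ∈ Ω, ‖φ x‖ ≤ 1) =>
      ENNReal.ofReal (∫ x in Ω, u x * divergence φ x)) Φ
      ⟨(contDiff_segmentAverage hψ hψc).smul contDiff_const,
        hC.of_isClosed_subset (isClosed_tsupport _) hts, hts.trans hCΩ, fun y _ => hΦ1 y⟩ le_rfl
  have hle' := (ENNReal.ofReal_le_iff_le_toReal htop).1 hle
  have hi : ∀ {f g : EuclideanSpace ℝ (Fin d) → ℝ}, Integrable f → Continuous g →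
      (∀ x, |g x| ≤ 1) → Integrable fun x => f x * g x := fun hf hg hb =>
    hf.mul_bdd (c := 1) hg.aestronglyMeasurable (Eventually.of_forall fun x => by simpa using hb x)
  have hi1 := hi hu' hψ.continuous hψ1
  have hi2 := hi hui hψ.continuous hψ1
  have hi3 : Integrable fun x => u x * ψ (x - v) :=
    hi hui (hψ.continuous.comp (continuous_sub_right v)) fun x => hψ1 (x - v)
  have hshift : ∫ x, u (x + v) * ψ x = ∫ x, u x * ψ (x - v) := by
    rw [← integral_add_right_eq_self (fun x => u x * ψ (x - v)) v]
    simp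
  have heq : ∫ x in Ω, u x * divergence Φ x = c⁻¹ * ∫ x, (u (x + v) - u x) * ψ x := by
    rw [setIntegral_eq_integral_of_forall_compl_eq_zero]
    · simp_rw [hdiv, sub_mul]
      rw [integral_sub hi1 hi2, hshift, ← integral_sub hi3 hi2, ← integral_const_mul]
      refine integral_congr_ae (Eventually.of_forall fun x => ?_)
      ring
    · intro x hx
      rw [hdiv, hψ0 x fun h' => hx (by simpa using hseg x h' 0 (by simp)),
        hψ0 (x - v) fun h' => hx (by simpa using hseg _ h' 1 (by simp))]
      simp
  rw [heq, inv_mul_le_iff₀ hc] at hle'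
  exact hle'

/-! ### Poincaré sets -/

/-- `A` is a Poincaré set for `Ω` if every `u` is, up to a constant depending on `u`, controlled
in `L¹(A)` by its total variation in `Ω`. -/
def IsPoincareSet (Ω A : Set (EuclideanSpace ℝ (Fin d))) : Prop :=
  volume A ≠ ∞ ∧ ∃ C : ℝ≥0∞, C ≠ ∞ ∧ ∀ u : EuclideanSpace ℝ (Fin d) → ℝ, Measurable u →
    Integrable u → ∃ c : ℝ, ∫⁻ x in A, ‖u x - c‖ₑ ≤ C * bvSeminorm Ω u

lemma IsPoincareSet.mono {Ω A B : Set (EuclideanSpace ℝ (Fin d))} (hB : IsPoincareSet Ω B)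
    (h : A ⊆ B) : IsPoincareSet Ω A := by
  obtain ⟨hv, C, hC, hB⟩ := hB
  refine ⟨(measure_mono h |>.trans_lt hv.lt_top).ne, C, hC, fun u hu hui => ?_⟩
  obtain ⟨c, hc⟩ := hB u hu hui
  exact ⟨c, (lintegral_mono_set h).trans hc⟩

/-- Fubini's theorem in the variables `y` and `h = x - y`. -/
lemma setLIntegral_setLIntegral_enorm_sub {u : EuclideanSpace ℝ (Fin d) → ℝ} (hu : Measurable u)
    {B : Set (EuclideanSpace ℝ (Fin d))} (hB : MeasurableSet B) :
    ∫⁻ y in B, ∫⁻ x in B, ‖u x - u y‖ₑ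
      = ∫⁻ h, ∫⁻ y in B ∩ {y | y + h ∈ B}, ‖u (y + h) - u y‖ₑ := by
  set f : EuclideanSpace ℝ (Fin d) → EuclideanSpace ℝ (Fin d) → ℝ≥0∞ := fun y h =>
    (B ∩ {y | y + h ∈ B}).indicator (fun y => ‖u (y + h) - u y‖ₑ) y
  have hf : Measurable (Function.uncurry f) := by
    have h1 : Function.uncurry f = {p : EuclideanSpace ℝ (Fin d) × EuclideanSpace ℝ (Fin d) |
        p.1 ∈ B ∧ p.1 + p.2 ∈ B}.indicator fun p => ‖u (p.1 + p.2) - u p.1‖ₑ := rfl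
    rw [h1]
    refine Measurable.indicator (by fun_prop) ?_
    exact (hB.preimage measurable_fst).inter (hB.preimage (measurable_fst.add measurable_snd))
  calc ∫⁻ y in B, ∫⁻ x in B, ‖u x - u y‖ₑ = ∫⁻ y, ∫⁻ h, f y h := by
        rw [← lintegral_indicator hB]
        refine lintegral_congr fun y => ?_
        by_cases hy : y ∈ B
        · rw [indicator_of_mem hy, ← lintegral_indicator hB, ← lintegral_add_left_eq_self _ y]
          refine lintegral_congr fun h => ?_
          by_cases hh : y + h ∈ B
          · have h1 : f y h = ‖u (y + h) - u y‖ₑ :=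
              indicator_of_mem (s := B ∩ {y | y + h ∈ B}) ⟨hy, hh⟩ _
            rw [indicator_of_mem hh, h1]
          · have h1 : f y h = 0 :=
              indicator_of_notMem (s := B ∩ {y | y + h ∈ B}) (fun h' => hh h'.2) _
            rw [indicator_of_notMem hh, h1]
        · rw [indicator_of_notMem hy]
          symm
          refine (lintegral_congr fun h => ?_).trans lintegral_zero
          exact indicator_of_notMem (fun h' => hy h'.1) _
    _ = ∫⁻ h, ∫⁻ y, f y h := lintegral_lintegral_swap hf.aemeasurable
    _ = ∫⁻ h, ∫⁻ y in B ∩ {y | y + h ∈ B}, ‖u (y + h) - u y‖ₑ :=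
        lintegral_congr fun h => lintegral_indicator
          (hB.inter (hB.preimage (measurable_id.add_const h))) _

/-- For convex sets the Poincaré inequality follows from the translation estimate, integrated over
all translations. -/
lemma isPoincareSet_ball {Ω : Set (EuclideanSpace ℝ (Fin d))} {x₀ : EuclideanSpace ℝ (Fin d)}
    {r : ℝ} (hr : 0 < r) (hΩ : ball x₀ r ⊆ Ω) : IsPoincareSet Ω (ball x₀ r) := by
  set B := ball x₀ r
  have hB0 : volume B ≠ 0 := (measure_ball_pos volume x₀ hr).ne'
  have hBt : volume B ≠ ∞ := measure_ball_lt_top.ne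
  have hBm : MeasurableSet B := measurableSet_ball
  refine ⟨hBt, ENNReal.ofReal (2 * r) * volume (ball (0 : EuclideanSpace ℝ (Fin d)) (2 * r))
    / volume B, ENNReal.div_ne_top (ENNReal.mul_ne_top ENNReal.ofReal_ne_top
      measure_ball_lt_top.ne) hB0, fun u hu hui => ?_⟩
  set D : EuclideanSpace ℝ (Fin d) → Set (EuclideanSpace ℝ (Fin d)) := fun h => B ∩ {y | y + h ∈ B}
  have hDo : ∀ h, IsOpen (D h) := fun h =>
    isOpen_ball.inter (isOpen_ball.preimage (continuous_add_const h))
  -- the translation estimate for a single `h`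
  have hstep : ∀ h, ∫⁻ y in D h, ‖u (y + h) - u y‖ₑ
      ≤ (ball (0 : EuclideanSpace ℝ (Fin d)) (2 * r)).indicator
        (fun _ => ENNReal.ofReal (2 * r) * bvSeminorm Ω u) h := by
    intro h
    by_cases hh : h ∈ ball (0 : EuclideanSpace ℝ (Fin d)) (2 * r)
    · rw [indicator_of_mem hh]
      refine lintegral_translate_sub_le hu hui (hDo h) (fun y hy s hs => hΩ ?_) (by positivity)
        fun y => ?_
      · exact (convex_ball x₀ r).add_smul_mem hy.1 hy.2 hs
      · have h1 : volume {s : ℝ | s ∈ Icc (0 : ℝ) 1 ∧ y - s • h ∈ D h} ≤ 1 :=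
          (measure_mono fun s hs => hs.1).trans (by simp : volume (Icc (0 : ℝ) 1) ≤ 1)
        refine (mul_le_mul_left h1 _).trans ?_
        rw [one_mul]
        exact ENNReal.ofReal_le_ofReal (mem_ball_zero_iff.1 hh).le
    · have : D h = ∅ := by
        rw [eq_empty_iff_forall_notMem]
        rintro y ⟨h1, h2⟩
        have h1' : dist y x₀ < r := h1
        have h2' : dist (y + h) x₀ < r := h2
        refine hh (mem_ball_zero_iff.2 ?_)
        calc ‖h‖ = dist (y + h) y := by rw [dist_eq_norm, add_sub_cancel_left]
          _ ≤ dist (y + h) x₀ + dist y x₀ := dist_triangle_right _ _ _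
          _ < 2 * r := by linarith
      simp [this]
  have hdouble : ∫⁻ y in B, ∫⁻ x in B, ‖u x - u y‖ₑ
      ≤ ENNReal.ofReal (2 * r) * volume (ball (0 : EuclideanSpace ℝ (Fin d)) (2 * r))
        * bvSeminorm Ω u := by
    rw [setLIntegral_setLIntegral_enorm_sub hu hBm]
    refine (lintegral_mono hstep).trans_eq ?_
    rw [lintegral_indicator measurableSet_ball, setLIntegral_const]
    ring
  have hmeas : Measurable fun y => ∫⁻ x in B, ‖u x - u y‖ₑ := by
    refine Measurable.lintegral_prod_right' (ν := volume.restrict B)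
      (f := fun p : EuclideanSpace ℝ (Fin d) × EuclideanSpace ℝ (Fin d) => ‖u p.2 - u p.1‖ₑ) ?_
    fun_prop
  obtain ⟨y, -, hy⟩ := exists_le_setLAverage hB0 hBt hmeas.aemeasurable
  refine ⟨u y, hy.trans ?_⟩
  rw [setLAverage_eq, ENNReal.mul_div_right_comm.symm]
  exact ENNReal.div_le_div_right hdouble _

lemma IsPoincareSet.union {Ω A B : Set (EuclideanSpace ℝ (Fin d))} (hA : IsPoincareSet Ω A)
    (hB : IsPoincareSet Ω B) (h : volume (A ∩ B) ≠ 0) : IsPoincareSet Ω (A ∪ B) := by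
  obtain ⟨hvA, C₁, hC₁, hA⟩ := hA
  obtain ⟨hvB, C₂, hC₂, hB⟩ := hB
  have hvAB : volume (A ∩ B) ≠ ∞ := (measure_mono inter_subset_left |>.trans_lt hvA.lt_top).ne
  refine ⟨(measure_union_lt_top hvA.lt_top hvB.lt_top).ne,
    C₁ + (C₂ + (C₁ + C₂) / volume (A ∩ B) * volume B), ?_, fun u hu hui => ?_⟩
  · have := ENNReal.div_ne_top (ENNReal.add_ne_top.2 ⟨hC₁, hC₂⟩) h
    finiteness
  obtain ⟨c₁, h₁⟩ := hA u hu hui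
  obtain ⟨c₂, h₂⟩ := hB u hu hui
  have hm : ∀ c : ℝ, Measurable fun x => ‖u x - c‖ₑ := fun c => by fun_prop
  have hcc : ‖c₂ - c₁‖ₑ ≤ (C₁ + C₂) / volume (A ∩ B) * bvSeminorm Ω u := by
    rw [ENNReal.mul_div_right_comm.symm, ENNReal.le_div_iff_mul_le (Or.inl h) (Or.inl hvAB),
      ← setLIntegral_const, add_mul]
    calc ∫⁻ _ in A ∩ B, ‖c₂ - c₁‖ₑ ≤ ∫⁻ x in A ∩ B, (‖u x - c₁‖ₑ + ‖u x - c₂‖ₑ) := by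
          refine lintegral_mono fun x => ?_
          have : c₂ - c₁ = (u x - c₁) - (u x - c₂) := by ring
          rw [this]
          exact enorm_sub_le
      _ = (∫⁻ x in A ∩ B, ‖u x - c₁‖ₑ) + ∫⁻ x in A ∩ B, ‖u x - c₂‖ₑ :=
          lintegral_add_left (hm c₁) _
      _ ≤ _ := add_le_add ((lintegral_mono_set inter_subset_left).trans h₁)
          ((lintegral_mono_set inter_subset_right).trans h₂)
  refine ⟨c₁, (lintegral_union_le _ _ _).trans ?_⟩
  rw [add_mul, add_mul]
  refine add_le_add h₁ ?_
  calc ∫⁻ x in B, ‖u x - c₁‖ₑ ≤ ∫⁻ x in B, (‖u x - c₂‖ₑ + ‖c₂ - c₁‖ₑ) := by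
        refine lintegral_mono fun x => ?_
        have : u x - c₁ = (u x - c₂) + (c₂ - c₁) := by ring
        rw [this]
        exact enorm_add_le _ _
    _ = (∫⁻ x in B, ‖u x - c₂‖ₑ) + ‖c₂ - c₁‖ₑ * volume B := by
        rw [lintegral_add_left (hm c₂), setLIntegral_const]
    _ ≤ _ := by
        refine add_le_add h₂ ((mul_le_mul_left hcc _).trans_eq ?_)
        ring

/-- Chains of balls: in a connected open set, every point has a neighbourhood that lies in a
Poincaré set containing a prescribed ball. -/
lemma exists_isPoincareSet_mem_nhds {Ω : Set (EuclideanSpace ℝ (Fin d))} (hΩ : IsOpen Ω)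
    (hconn : IsPreconnected Ω) {x₀ : EuclideanSpace ℝ (Fin d)} {r₀ : ℝ} (hr₀ : 0 < r₀)
    (h₀ : ball x₀ r₀ ⊆ Ω) {x : EuclideanSpace ℝ (Fin d)} (hx : x ∈ Ω) :
    ∃ A ∈ 𝓝 x, ball x₀ r₀ ⊆ A ∧ IsPoincareSet Ω A := by
  suffices h : Ω ⊆ {x | ∃ A ∈ 𝓝 x, ball x₀ r₀ ⊆ A ∧ IsPoincareSet Ω A} from h hx
  refine hconn.subset_of_closure_inter_subset ?_ ?_ ?_
  · refine isOpen_iff_mem_nhds.2 fun y ⟨A, hA, h1, h2⟩ => ?_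
    filter_upwards [eventually_mem_nhds_iff.2 hA] with z hz using ⟨A, hz, h1, h2⟩
  · exact ⟨x₀, h₀ (mem_ball_self hr₀), ball x₀ r₀, ball_mem_nhds _ hr₀, subset_rfl,
      isPoincareSet_ball hr₀ h₀⟩
  · rintro y ⟨hy, hyΩ⟩
    obtain ⟨r, hr, hball⟩ := Metric.isOpen_iff.1 hΩ y hyΩ
    obtain ⟨z, hz, A, hA, h1, h2⟩ := mem_closure_iff.1 hy _ isOpen_ball (mem_ball_self hr)
    refine ⟨A ∪ ball y r, mem_of_superset (ball_mem_nhds y hr) subset_union_right,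
      h1.trans subset_union_left, h2.union (isPoincareSet_ball hr hball) ?_⟩
    exact (Measure.measure_pos_of_mem_nhds volume (inter_mem hA (isOpen_ball.mem_nhds hz))).ne'

/-- Poincaré sets that share a ball and cover a compact set locally, cover it globally. -/
lemma exists_isPoincareSet_superset {Ω K T : Set (EuclideanSpace ℝ (Fin d))} (hK : IsCompact K)
    {x₀ : EuclideanSpace ℝ (Fin d)} {r₀ : ℝ} (hr₀ : 0 < r₀) (h₀ : ball x₀ r₀ ⊆ Ω)
    (h : ∀ x ∈ K, ∃ V ∈ 𝓝 x, ∃ A, V ∩ T ⊆ A ∧ ball x₀ r₀ ⊆ A ∧ IsPoincareSet Ω A) :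
    ∃ A, K ∩ T ⊆ A ∧ ball x₀ r₀ ⊆ A ∧ IsPoincareSet Ω A := by
  refine hK.induction_on (p := fun s => ∃ A, s ∩ T ⊆ A ∧ ball x₀ r₀ ⊆ A ∧ IsPoincareSet Ω A)
    ⟨_, by simp, subset_rfl, isPoincareSet_ball hr₀ h₀⟩ ?_ ?_ ?_
  · rintro s t hst ⟨A, h1, h2⟩
    exact ⟨A, (inter_subset_inter_left _ hst).trans h1, h2⟩
  · rintro s t ⟨A, h1, h2, h3⟩ ⟨B, h4, h5, h6⟩
    refine ⟨A ∪ B, ?_, h2.trans subset_union_left, h3.union h6 ?_⟩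
    · rw [union_inter_distrib_right]
      exact union_subset_union h1 h4
    · exact ((measure_ball_pos volume x₀ hr₀).trans_le (measure_mono (subset_inter h2 h5))).ne'
  · intro x hx
    obtain ⟨V, hV, hA⟩ := h x hx
    exact ⟨V, mem_nhdsWithin_of_mem_nhds hV, hA⟩

lemma exists_isPoincareSet_of_isCompact {Ω K : Set (EuclideanSpace ℝ (Fin d))} (hΩ : IsOpen Ω)
    (hconn : IsPreconnected Ω) {x₀ : EuclideanSpace ℝ (Fin d)} {r₀ : ℝ} (hr₀ : 0 < r₀)
    (h₀ : ball x₀ r₀ ⊆ Ω) (hK : IsCompact K) (hKΩ : K ⊆ Ω) :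
    ∃ A, K ⊆ A ∧ ball x₀ r₀ ⊆ A ∧ IsPoincareSet Ω A := by
  obtain ⟨A, h1, h2⟩ := exists_isPoincareSet_superset (T := univ) hK hr₀ h₀ fun x hx => by
    obtain ⟨A, hA, h1, h2⟩ := exists_isPoincareSet_mem_nhds hΩ hconn hr₀ h₀ (hKΩ hx)
    exact ⟨A, hA, A, inter_subset_left, h1, h2⟩
  exact ⟨A, by simpa using h1, h2⟩

/-! ### Boundary charts -/

/-- A coordinate-free graph chart of `Ω` at a boundary point `x₀`: in the ball of radius `r`, the
set `Ω` is `{ρ > 0}` for an `L`-Lipschitz function `ρ` that grows with unit speed in the direction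
of the unit vector `e`. For `Ω` above the graph of `φ` it is the height `ρ = ξ_d - φ(ξ')`. -/
structure IsGraphChart (Ω : Set (EuclideanSpace ℝ (Fin d))) (x₀ : EuclideanSpace ℝ (Fin d)) (r : ℝ)
    (e : EuclideanSpace ℝ (Fin d)) (ρ : EuclideanSpace ℝ (Fin d) → ℝ) (L : ℝ) : Prop where
  r_pos : 0 < r
  norm_e : ‖e‖ = 1
  one_le : 1 ≤ L
  lipschitz : ∀ x y, |ρ x - ρ y| ≤ L * dist x y
  add_smul : ∀ x (s : ℝ), ρ (x + s • e) = ρ x + s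
  mem_iff : ∀ x ∈ ball x₀ r, (x ∈ Ω ↔ 0 < ρ x)
  isOpen : IsOpen Ω
  mem_frontier : x₀ ∈ frontier Ω

lemma norm_initial_coords_le {n : ℕ} (z : EuclideanSpace ℝ (Fin (n + 1))) :
    ‖(WithLp.toLp 2 fun i : Fin n => z i.castSucc : EuclideanSpace ℝ (Fin n))‖ ≤ ‖z‖ := by
  rw [EuclideanSpace.norm_eq, EuclideanSpace.norm_eq]
  refine Real.sqrt_le_sqrt ?_
  rw [Fin.sum_univ_castSucc (f := fun i => ‖z i‖ ^ 2)]
  simpa using sq_nonneg (z (Fin.last n))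

/-- By the Mazur–Ulam theorem the isometry in the definition of a Lipschitz domain is affine, so
that the vertical direction pulls back to a fixed unit vector. -/
lemma IsBoundedLipschitzDomain.exists_isGraphChart {n : ℕ}
    {Ω : Set (EuclideanSpace ℝ (Fin (n + 1)))} (hΩ : IsBoundedLipschitzDomain Ω)
    {x₀ : EuclideanSpace ℝ (Fin (n + 1))} (hx₀ : x₀ ∈ frontier Ω) :
    ∃ r e ρ L, IsGraphChart Ω x₀ r e ρ L := by
  obtain ⟨r, hr, T, φ, ⟨K, hφ⟩, hT⟩ := hΩ.exists_graph x₀ hx₀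
  set A := T.toRealAffineIsometryEquiv
  have hA : ∀ x, A x = T x := fun x => rfl
  set ed : EuclideanSpace ℝ (Fin (n + 1)) := EuclideanSpace.single (Fin.last n) 1
  set e := A.linearIsometryEquiv.symm ed
  have hshift : ∀ x (s : ℝ), T (x + s • e) = T x + s • ed := by
    intro x s
    have h1 := A.map_vadd x (s • e)
    rw [map_smul] at h1
    simp only [vadd_eq_add, hA, e, LinearIsometryEquiv.apply_symm_apply] at h1
    rw [add_comm x, h1]
    exact add_comm _ _
  refine ⟨r, e, fun x => T x (Fin.last n) - φ (WithLp.toLp 2 fun i : Fin n => T x i.castSucc),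
    1 + K, hr, ?_, ?_, ?_, ?_, ?_, hΩ.isOpen, hx₀⟩
  · rw [LinearIsometryEquiv.norm_map, PiLp.norm_single, norm_one]
  · have := K.2; simp
  · intro x y
    have h1 : |T x (Fin.last n) - T y (Fin.last n)| ≤ dist x y := by
      rw [← T.dist_eq x y, dist_eq_norm]
      exact PiLp.norm_apply_le (T x - T y) (Fin.last n)
    have h2 : |φ (WithLp.toLp 2 fun i : Fin n => T x i.castSucc)
        - φ (WithLp.toLp 2 fun i : Fin n => T y i.castSucc)| ≤ K * dist x y := by
      refine (hφ.dist_le_mul _ _).trans (mul_le_mul_of_nonneg_left ?_ K.2)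
      rw [← T.dist_eq x y, dist_eq_norm, dist_eq_norm]
      exact norm_initial_coords_le (T x - T y)
    rw [abs_le] at *
    constructor <;> linarith [h1.1, h1.2, h2.1, h2.2]
  · intro x s
    have h1 : (fun i : Fin n => (T x + s • ed) i.castSucc) = fun i : Fin n => T x i.castSucc := by
      funext i
      simp [ed, (Fin.castSucc_lt_last i).ne]
    simp only [hshift, h1]
    simp [ed]
    ring
  · intro x hx
    have hx' : T x ∈ ball (T x₀) r := by rwa [mem_ball, T.dist_eq]
    have h1 := Set.ext_iff.1 hT (T x)
    simp only [mem_inter_iff, hx', and_true, T.injective.mem_set_image] at h1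
    rw [h1, sub_pos]
    rfl

namespace IsGraphChart

variable {Ω : Set (EuclideanSpace ℝ (Fin d))} {x₀ : EuclideanSpace ℝ (Fin d)} {r : ℝ}
  {e : EuclideanSpace ℝ (Fin d)} {ρ : EuclideanSpace ℝ (Fin d) → ℝ} {L : ℝ}

lemma continuous (h : IsGraphChart Ω x₀ r e ρ L) : Continuous ρ := by
  have hL : 0 ≤ L := zero_le_one.trans h.one_le
  exact (LipschitzWith.of_dist_le_mul (K := ⟨L, hL⟩) fun x y => h.lipschitz x y).continuous

lemma eq_zero_of_mem_frontier (h : IsGraphChart Ω x₀ r e ρ L) {y : EuclideanSpace ℝ (Fin d)}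
    (hy : y ∈ frontier Ω) (hyr : y ∈ ball x₀ r) : ρ y = 0 := by
  rw [h.isOpen.frontier_eq] at hy
  refine le_antisymm (not_lt.1 fun h' => hy.2 ((h.mem_iff y hyr).2 h')) (not_lt.1 fun h' => ?_)
  obtain ⟨z, ⟨hz1, hz2⟩, hzΩ⟩ := mem_closure_iff.1 hy.1 _
    (isOpen_ball.inter (isOpen_lt h.continuous continuous_const)) ⟨hyr, h'⟩
  exact lt_asymm ((h.mem_iff z hz1).1 hzΩ) hz2

lemma abs_lt (h : IsGraphChart Ω x₀ r e ρ L) {H : ℝ} {x : EuclideanSpace ℝ (Fin d)}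
    (hx : x ∈ ball x₀ (H / L)) : |ρ x| < H := by
  have hL : 0 < L := zero_lt_one.trans_le h.one_le
  have h1 := h.lipschitz x x₀
  rw [h.eq_zero_of_mem_frontier h.mem_frontier (mem_ball_self h.r_pos), sub_zero] at h1
  have h2 := (lt_div_iff₀' hL).1 (mem_ball.1 hx)
  exact h1.trans_lt h2

lemma ball_subset (h : IsGraphChart Ω x₀ r e ρ L) {H : ℝ} (hH : 0 ≤ H) :
    ball x₀ (H / L) ⊆ ball x₀ H :=
  ball_subset_ball (div_le_self hH h.one_le)

lemma add_smul_mem_ball (h : IsGraphChart Ω x₀ r e ρ L) {H : ℝ} (hH : 0 < H) (hHr : 4 * H ≤ r)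
    {x : EuclideanSpace ℝ (Fin d)} (hx : x ∈ ball x₀ (H / L)) {s : ℝ} (hs : |s| ≤ 3 * H) :
    x + s • e ∈ ball x₀ r := by
  have h1 := mem_ball.1 (h.ball_subset hH.le hx)
  rw [mem_ball]
  calc dist (x + s • e) x₀ ≤ dist (x + s • e) x + dist x x₀ := dist_triangle _ _ _
    _ = |s| + dist x x₀ := by
        rw [dist_eq_norm, add_sub_cancel_left, norm_smul, h.norm_e, mul_one, Real.norm_eq_abs]
    _ < r := by linarith

lemma mem_iff_of_mem_ball (h : IsGraphChart Ω x₀ r e ρ L) {H : ℝ} (hH : 0 < H) (hHr : 4 * H ≤ r)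
    {x : EuclideanSpace ℝ (Fin d)} (hx : x ∈ ball x₀ (H / L)) : x ∈ Ω ↔ 0 < ρ x := by
  refine h.mem_iff x (ball_subset_ball ?_ (h.ball_subset hH.le hx))
  linarith

lemma add_smul_mem (h : IsGraphChart Ω x₀ r e ρ L) {H : ℝ} (hH : 0 < H) (hHr : 4 * H ≤ r)
    {x : EuclideanSpace ℝ (Fin d)} (hx : x ∈ ball x₀ (H / L)) (hxΩ : x ∈ Ω) {s : ℝ} (hs : 0 ≤ s)
    (hs' : s ≤ 3 * H) : x + s • e ∈ Ω := by
  rw [h.mem_iff _ (h.add_smul_mem_ball hH hHr hx (by rwa [abs_of_nonneg hs])), h.add_smul]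
  have := (h.mem_iff_of_mem_ball hH hHr hx).1 hxΩ
  linarith

lemma bdryDist_le (h : IsGraphChart Ω x₀ r e ρ L) {H : ℝ} (hH : 0 < H) (hHr : 4 * H ≤ r)
    {x : EuclideanSpace ℝ (Fin d)} (hx : x ∈ ball x₀ (H / L)) (hxΩ : x ∈ Ω) :
    bdryDist Ω x ≤ ρ x := by
  have h0 := (h.mem_iff_of_mem_ball hH hHr hx).1 hxΩ
  have hlt := (le_abs_self _).trans_lt (h.abs_lt hx)
  -- going down from `x` by `ρ x` leads to a boundary point
  have hball : ∀ s : ℝ, 0 ≤ s → s ≤ ρ x → x + (-s) • e ∈ ball x₀ r := fun s hs hs' =>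
    h.add_smul_mem_ball hH hHr hx (by rw [abs_neg, abs_of_nonneg hs]; linarith)
  have hfr : x + (-ρ x) • e ∈ frontier Ω := by
    rw [h.isOpen.frontier_eq]
    refine ⟨?_, ?_⟩
    · have hc : ContinuousWithinAt (fun s : ℝ => x + (-s) • e) (Iio (ρ x)) (ρ x) :=
        Continuous.continuousWithinAt (by fun_prop)
      refine mem_closure_of_tendsto hc ?_
      filter_upwards [Ioo_mem_nhdsLT h0] with s hs
      rw [h.mem_iff _ (hball s hs.1.le hs.2.le), h.add_smul]
      linarith [hs.2]
    · rw [h.mem_iff _ (hball _ h0.le le_rfl), h.add_smul]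
      simp
  refine (infDist_le_dist_of_mem hfr).trans_eq ?_
  rw [dist_eq_norm, sub_add_cancel_left, norm_neg, norm_smul, h.norm_e, mul_one, norm_neg,
    Real.norm_of_nonneg h0.le]

lemma le_mul_bdryDist (h : IsGraphChart Ω x₀ r e ρ L) {H : ℝ} (hH : 0 < H) (hHr : 4 * H ≤ r)
    {x : EuclideanSpace ℝ (Fin d)} (hx : x ∈ ball x₀ (H / L)) : ρ x ≤ L * bdryDist Ω x := by
  have hL : 0 < L := zero_lt_one.trans_le h.one_le
  rw [← div_le_iff₀' hL]
  refine (le_infDist ⟨x₀, h.mem_frontier⟩).2 fun y hy => ?_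
  rw [div_le_iff₀' hL]
  by_cases hyr : y ∈ ball x₀ r
  · have h1 := h.lipschitz x y
    rw [h.eq_zero_of_mem_frontier hy hyr, sub_zero] at h1
    exact (le_abs_self _).trans h1
  · have h1 := mem_ball.1 (h.ball_subset hH.le hx)
    have h2 : r ≤ dist y x₀ := not_lt.1 hyr
    have h3 := dist_triangle y x x₀
    rw [dist_comm y x] at h3
    have h4 := (le_abs_self _).trans_lt (h.abs_lt hx)
    have h5 : dist x y ≤ L * dist x y := le_mul_of_one_le_left dist_nonneg h.one_le
    linarith

/-- Poincaré sets extend to the boundary: the part of `Ω` near a boundary point is moved into a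
compact subset of `Ω` by a fixed translation. -/
lemma exists_isPoincareSet (h : IsGraphChart Ω x₀ r e ρ L) (hconn : IsPreconnected Ω)
    {z : EuclideanSpace ℝ (Fin d)} {r₀ : ℝ} (hr₀ : 0 < r₀) (h₀ : ball z r₀ ⊆ Ω) :
    ∃ V ∈ 𝓝 x₀, ∃ A, V ∩ Ω ⊆ A ∧ ball z r₀ ⊆ A ∧ IsPoincareSet Ω A := by
  have hL : 0 < L := zero_lt_one.trans_le h.one_le
  set H := r / 4
  have hH : 0 < H := div_pos h.r_pos (by norm_num)
  have hHr : 4 * H ≤ r := by simp only [H]; linarith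
  set K := closedBall x₀ (2 * H) ∩ {y | H ≤ ρ y}
  have hK : IsCompact K :=
    (isCompact_closedBall x₀ _).inter_right (isClosed_le continuous_const h.continuous)
  have hKΩ : K ⊆ Ω := by
    rintro y ⟨h1, h2⟩
    refine (h.mem_iff y ((mem_closedBall.1 h1).trans_lt (by linarith))).2 ?_
    exact hH.trans_le h2
  obtain ⟨A, hKA, hzA, hvA, C, hC, hA⟩ :=
    exists_isPoincareSet_of_isCompact h.isOpen hconn hr₀ h₀ hK hKΩ
  set S := ball x₀ (H / L) ∩ Ω
  have hSo : IsOpen S := isOpen_ball.inter h.isOpen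
  have hSK : ∀ x ∈ S, x + H • e ∈ K := by
    intro x hx
    refine ⟨?_, ?_⟩
    · have h1 := mem_ball.1 (h.ball_subset hH.le hx.1)
      calc dist (x + H • e) x₀ ≤ dist (x + H • e) x + dist x x₀ := dist_triangle _ _ _
        _ = H + dist x x₀ := by
            rw [dist_eq_norm, add_sub_cancel_left, norm_smul, h.norm_e, mul_one,
              Real.norm_of_nonneg hH.le]
        _ ≤ 2 * H := by linarith
    · have := (h.mem_iff_of_mem_ball hH hHr hx.1).1 hx.2
      show H ≤ ρ (x + H • e)
      rw [h.add_smul]; linarith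
  have hvS : volume S < ∞ := (measure_mono inter_subset_left).trans_lt measure_ball_lt_top
  refine ⟨ball x₀ (H / L), ball_mem_nhds _ (div_pos hH hL), A ∪ S, subset_union_right,
    hzA.trans subset_union_left, (measure_union_lt_top hvA.lt_top hvS).ne,
    C + (ENNReal.ofReal H + C), by finiteness, fun u hu hui => ?_⟩
  obtain ⟨c, hc⟩ := hA u hu hui
  refine ⟨c, (lintegral_union_le _ _ _).trans ?_⟩
  rw [add_mul, add_mul]
  refine add_le_add hc ?_
  have h1 : ∫⁻ x in S, ‖u (x + H • e) - u x‖ₑ ≤ ENNReal.ofReal H * bvSeminorm Ω u := by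
    refine lintegral_translate_sub_le hu hui hSo (fun x hx s hs => ?_) hH fun y => ?_
    · rw [smul_smul]
      refine h.add_smul_mem hH hHr hx.1 hx.2 (mul_nonneg hs.1 hH.le) ?_
      nlinarith [hs.2]
    · have h1 : volume {s : ℝ | s ∈ Icc (0 : ℝ) 1 ∧ y - s • H • e ∈ S} ≤ 1 :=
        (measure_mono fun s hs => hs.1).trans (by simp : volume (Icc (0 : ℝ) 1) ≤ 1)
      refine (mul_le_mul_left h1 _).trans ?_
      rw [one_mul, norm_smul, h.norm_e, mul_one, Real.norm_of_nonneg hH.le]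
  have h2 : ∫⁻ x in S, ‖u (x + H • e) - c‖ₑ ≤ C * bvSeminorm Ω u := by
    refine le_trans ?_ ((lintegral_mono_set hKA).trans hc)
    rw [← lintegral_indicator hK.measurableSet, ← lintegral_indicator hSo.measurableSet,
      ← lintegral_add_right_eq_self (K.indicator _) (H • e)]
    refine lintegral_mono fun x => ?_
    by_cases hx : x ∈ S
    · rw [indicator_of_mem hx, indicator_of_mem (hSK x hx)]
    · rw [indicator_of_notMem hx]; exact zero_le
  calc ∫⁻ x in S, ‖u x - c‖ₑ
      ≤ ∫⁻ x in S, (‖u (x + H • e) - u x‖ₑ + ‖u (x + H • e) - c‖ₑ) := by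
        refine lintegral_mono fun x => ?_
        have : u x - c = (u (x + H • e) - c) - (u (x + H • e) - u x) := by ring
        rw [this]
        exact enorm_sub_le.trans_eq (add_comm _ _)
    _ = (∫⁻ x in S, ‖u (x + H • e) - u x‖ₑ) + ∫⁻ x in S, ‖u (x + H • e) - c‖ₑ :=
        lintegral_add_left (by fun_prop) _
    _ ≤ _ := add_le_add h1 h2

end IsGraphChart

/-! ### The Poincaré inequality -/

lemma IsBoundedLipschitzDomain.isPoincareSet {n : ℕ}
    {Ω : Set (EuclideanSpace ℝ (Fin (n + 1)))} (hΩ : IsBoundedLipschitzDomain Ω) :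
    IsPoincareSet Ω Ω := by
  obtain ⟨z, hz⟩ := hΩ.isConnected.nonempty
  obtain ⟨r₀, hr₀, h₀⟩ := Metric.isOpen_iff.1 hΩ.isOpen z hz
  have hconn := hΩ.isConnected.isPreconnected
  obtain ⟨A, h1, -, h2⟩ := exists_isPoincareSet_superset (T := Ω)
    hΩ.isBounded.isCompact_closure hr₀ h₀ fun x hx => by
      by_cases hxΩ : x ∈ Ω
      · obtain ⟨A, hA, h1, h2⟩ := exists_isPoincareSet_mem_nhds hΩ.isOpen hconn hr₀ h₀ hxΩ
        exact ⟨A, hA, A, inter_subset_left, h1, h2⟩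
      · have hfr : x ∈ frontier Ω := by rw [hΩ.isOpen.frontier_eq]; exact ⟨hx, hxΩ⟩
        obtain ⟨r, e, ρ, L, hchart⟩ := hΩ.exists_isGraphChart hfr
        exact hchart.exists_isPoincareSet hconn hr₀ h₀
  exact h2.mono fun x hx => h1 ⟨subset_closure hx, hx⟩

lemma enorm_average_sub_mul_le {A : Set (EuclideanSpace ℝ (Fin d))} (h0 : volume A ≠ 0)
    (ht : volume A ≠ ∞) {u : EuclideanSpace ℝ (Fin d) → ℝ} (hui : Integrable u) (c : ℝ) :
    ‖c - ⨍ y in A, u y‖ₑ * volume A ≤ ∫⁻ x in A, ‖u x - c‖ₑ := by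
  have h1 : ∫ x in A, (u x - c) = volume.real A * ((⨍ y in A, u y) - c) := by
    rw [integral_sub hui.integrableOn (integrableOn_const ht), setIntegral_const,
      setAverage_eq, smul_eq_mul, smul_eq_mul]
    have : volume.real A ≠ 0 := (ENNReal.toReal_pos h0 ht).ne'
    field_simp
  rw [← enorm_neg, neg_sub, mul_comm]
  refine le_trans ?_ (enorm_integral_le_lintegral_enorm _)
  rw [h1, enorm_mul, Measure.real, Real.enorm_of_nonneg ENNReal.toReal_nonneg,
    ENNReal.ofReal_toReal ht]

lemma IsPoincareSet.lintegral_enorm_sub_average_le {Ω A : Set (EuclideanSpace ℝ (Fin d))}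
    (h : IsPoincareSet Ω A) (h0 : volume A ≠ 0) :
    ∃ C : ℝ≥0∞, C ≠ ∞ ∧ ∀ u : EuclideanSpace ℝ (Fin d) → ℝ, Measurable u → Integrable u →
      ∫⁻ x in A, ‖u x - ⨍ y in A, u y‖ₑ ≤ C * bvSeminorm Ω u := by
  obtain ⟨ht, C, hC, h⟩ := h
  refine ⟨2 * C, by finiteness, fun u hu hui => ?_⟩
  obtain ⟨c, hc⟩ := h u hu hui
  set a := ⨍ y in A, u y
  calc ∫⁻ x in A, ‖u x - a‖ₑ ≤ ∫⁻ x in A, (‖u x - c‖ₑ + ‖c - a‖ₑ) := by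
        refine lintegral_mono fun x => ?_
        have : u x - a = (u x - c) + (c - a) := by ring
        rw [this]
        exact enorm_add_le _ _
    _ = (∫⁻ x in A, ‖u x - c‖ₑ) + ‖c - a‖ₑ * volume A := by
        rw [lintegral_add_left (by fun_prop), setLIntegral_const]
    _ ≤ (∫⁻ x in A, ‖u x - c‖ₑ) + ∫⁻ x in A, ‖u x - c‖ₑ := by
        gcongr
        exact enorm_average_sub_mul_le h0 ht hui c
    _ ≤ 2 * C * bvSeminorm Ω u := by
        rw [← two_mul, mul_assoc]
        gcongr

/-! ### The Hardy inequality near the boundary -/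

namespace IsGraphChart

variable {Ω : Set (EuclideanSpace ℝ (Fin d))} {x₀ : EuclideanSpace ℝ (Fin d)} {r : ℝ}
  {e : EuclideanSpace ℝ (Fin d)} {ρ : EuclideanSpace ℝ (Fin d) → ℝ} {L : ℝ}

/-- Layers `{ρ ∈ O}` are met by vertical lines in sets of measure `|O|`, so the improved translation
estimate shows that the image under `ρ` of the measure `|u(x + h e) - u(x)| dx` has density at most
`[u]`. This allows arbitrary weights depending on `ρ`. -/
lemma lintegral_translate_sub_mul_le (hch : IsGraphChart Ω x₀ r e ρ L) {H : ℝ} (hH : 0 < H)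
    (hHr : 4 * H ≤ r) {u : EuclideanSpace ℝ (Fin d) → ℝ} (hu : Measurable u) (hui : Integrable u)
    (hbv : bvSeminorm Ω u ≠ ∞) {h : ℝ} (h0 : 0 < h) (hh : h ≤ 2 * H)
    {g : ℝ → ℝ≥0∞} (hg : Measurable g) :
    ∫⁻ x in ball x₀ (H / L) ∩ Ω, g (ρ x) * ‖u (x + h • e) - u x‖ₑ
      ≤ (∫⁻ t in Ioc 0 H, g t) * bvSeminorm Ω u := by
  set S := ball x₀ (H / L) ∩ Ω
  have hSo : IsOpen S := isOpen_ball.inter hch.isOpen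
  have hρ := hch.continuous
  have hf : Measurable fun x => ‖u (x + h • e) - u x‖ₑ := by fun_prop
  have hρS : ∀ x ∈ S, ρ x ∈ Ioc 0 H := fun x hx =>
    ⟨(hch.mem_iff_of_mem_ball hH hHr hx.1).1 hx.2, ((le_abs_self _).trans_lt (hch.abs_lt hx.1)).le⟩
  set ν : Measure ℝ := ((volume.restrict S).withDensity fun x => ‖u (x + h • e) - u x‖ₑ).map ρ
  have hνA : ∀ A, MeasurableSet A → ν A = ∫⁻ x in S ∩ ρ ⁻¹' A, ‖u (x + h • e) - u x‖ₑ := by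
    intro A hA
    rw [Measure.map_apply hρ.measurable hA, withDensity_apply _ (hρ.measurable hA),
      Measure.restrict_restrict (hρ.measurable hA), inter_comm]
  have hopen : ∀ O : Set ℝ, IsOpen O → ∀ c : ℝ, 0 < c → volume O ≤ ENNReal.ofReal c →
      ν O ≤ ENNReal.ofReal c * bvSeminorm Ω u := by
    intro O hO c hc hOc
    rw [hνA O hO.measurableSet]
    refine lintegral_translate_sub_le hu hui (hSo.inter (hO.preimage hρ)) (fun x hx s hs => ?_) hc
      fun y => ?_
    · rw [smul_smul]
      refine hch.add_smul_mem hH hHr hx.1.1 hx.1.2 (mul_nonneg hs.1 h0.le) ?_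
      nlinarith [hs.1, hs.2]
    · have h1 : {s : ℝ | s ∈ Icc (0 : ℝ) 1 ∧ y - s • h • e ∈ S ∩ ρ ⁻¹' O}
          ⊆ (fun s => -h * s) ⁻¹' ((fun t => ρ y + t) ⁻¹' O) := by
        rintro s ⟨-, -, hs⟩
        have h2 : y - s • h • e = y + (-h * s) • e := by
          rw [smul_smul, sub_eq_add_neg, ← neg_smul]; congr 2; ring
        rw [h2, mem_preimage, hch.add_smul] at hs
        exact hs
      rw [norm_smul, hch.norm_e, mul_one, Real.norm_of_nonneg h0.le]
      refine (mul_le_mul_left (measure_mono h1) _).trans ?_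
      rw [Real.volume_preimage_mul_left (neg_ne_zero.2 h0.ne'), measure_preimage_add,
        abs_inv, abs_neg, abs_of_pos h0, mul_right_comm, ← ENNReal.ofReal_mul (inv_nonneg.2 h0.le),
        inv_mul_cancel₀ h0.ne', ENNReal.ofReal_one, one_mul]
      exact hOc
  have hνle : ν ≤ bvSeminorm Ω u • volume.restrict (Ioc 0 H) := by
    refine Measure.le_iff.2 fun A hA => ?_
    have h1 : ν A = ν (A ∩ Ioc 0 H) := by
      rw [hνA A hA, hνA _ (hA.inter measurableSet_Ioc)]
      congr 2
      ext x
      simp only [mem_inter_iff, mem_preimage]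
      exact ⟨fun hx => ⟨hx.1, hx.2, hρS x hx.1⟩, fun hx => ⟨hx.1, hx.2.1⟩⟩
    rw [h1, Measure.smul_apply, Measure.restrict_apply hA, smul_eq_mul, mul_comm]
    have hfin : volume (A ∩ Ioc 0 H) ≠ ∞ :=
      ((measure_mono inter_subset_right).trans_lt (by simp : volume (Ioc 0 H) < ∞)).ne
    -- outer regularity: enlarge `A ∩ (0, H]` to an open set of nearly the same measure
    set c₀ := (volume (A ∩ Ioc 0 H)).toReal
    have hlim : Tendsto (fun c => ENNReal.ofReal c * bvSeminorm Ω u) (𝓝[>] c₀)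
        (𝓝 (volume (A ∩ Ioc 0 H) * bvSeminorm Ω u)) := by
      rw [← ENNReal.ofReal_toReal hfin]
      exact ENNReal.Tendsto.mul_const
        ((ENNReal.tendsto_ofReal tendsto_id).mono_left nhdsWithin_le_nhds) (Or.inr hbv)
    refine ge_of_tendsto hlim ?_
    filter_upwards [self_mem_nhdsWithin] with c hc
    have hc0 : 0 < c := ENNReal.toReal_nonneg.trans_lt hc
    obtain ⟨O, hAO, hO, hOc⟩ := (A ∩ Ioc 0 H).exists_isOpen_lt_of_lt (μ := volume)
      (ENNReal.ofReal c) ((ENNReal.lt_ofReal_iff_toReal_lt hfin).2 hc)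
    exact (measure_mono hAO).trans (hopen O hO c hc0 hOc.le)
  calc ∫⁻ x in S, g (ρ x) * ‖u (x + h • e) - u x‖ₑ = ∫⁻ t, g t ∂ν := by
        rw [lintegral_map hg hρ.measurable,
          lintegral_withDensity_eq_lintegral_mul _ hf (g := fun x => g (ρ x))
            (hg.comp hρ.measurable)]
        refine lintegral_congr fun x => ?_
        simp [mul_comm]
    _ ≤ ∫⁻ t, g t ∂(bvSeminorm Ω u • volume.restrict (Ioc 0 H)) := lintegral_mono' hνle le_rfl
    _ = _ := by rw [lintegral_smul_measure, smul_eq_mul, mul_comm]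

/-- The local Hardy inequality. Averaging the translation estimate over the vertical shifts
`h ∈ (H, 2H]` replaces the weight, singular at the boundary, by a bounded one. -/
lemma lintegral_mul_sub_le (hch : IsGraphChart Ω x₀ r e ρ L) {H : ℝ} (hH : 0 < H)
    (hHr : 4 * H ≤ r) {u : EuclideanSpace ℝ (Fin d) → ℝ} (hu : Measurable u) (hui : Integrable u)
    (hbv : bvSeminorm Ω u ≠ ∞) {g : ℝ → ℝ≥0∞} (hg : Measurable g) (c : ℝ) :
    ∫⁻ x in ball x₀ (H / L) ∩ Ω, g (ρ x) * ‖u x - c‖ₑ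
      ≤ (∫⁻ t in Ioc 0 H, g t)
        * (bvSeminorm Ω u + (∫⁻ x in Ω, ‖u x - c‖ₑ) / ENNReal.ofReal H) := by
  set S := ball x₀ (H / L) ∩ Ω
  have hSm : MeasurableSet S := (isOpen_ball.inter hch.isOpen).measurableSet
  have hΩm : MeasurableSet Ω := hch.isOpen.measurableSet
  have hρ := hch.continuous.measurable
  have hρS : ∀ x ∈ S, ρ x ∈ Ioc 0 H := fun x hx =>
    ⟨(hch.mem_iff_of_mem_ball hH hHr hx.1).1 hx.2, ((le_abs_self _).trans_lt (hch.abs_lt hx.1)).le⟩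
  have hI : volume (Ioc H (2 * H)) = ENNReal.ofReal H := by
    rw [Real.volume_Ioc]; congr 1; ring
  have hH0 : ENNReal.ofReal H ≠ 0 := by simpa using hH
  -- the shifted term, after exchanging the integrals and undoing the shift
  have hshift : ∫⁻ h in Ioc H (2 * H), ∫⁻ x in S, g (ρ x) * ‖u (x + h • e) - c‖ₑ
      ≤ (∫⁻ t in Ioc 0 H, g t) * ∫⁻ x in Ω, ‖u x - c‖ₑ := by
    set G : ℝ → ℝ≥0∞ := (Ioc 0 H).indicator g
    have hG : Measurable G := hg.indicator measurableSet_Ioc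
    calc ∫⁻ h in Ioc H (2 * H), ∫⁻ x in S, g (ρ x) * ‖u (x + h • e) - c‖ₑ
        ≤ ∫⁻ h in Ioc H (2 * H), ∫⁻ y in Ω, G (ρ y - h) * ‖u y - c‖ₑ := by
          refine setLIntegral_mono' measurableSet_Ioc fun h hh => ?_
          rw [← lintegral_indicator hSm, ← lintegral_indicator hΩm,
            ← lintegral_add_right_eq_self (Ω.indicator _) (h • e)]
          refine lintegral_mono fun x => ?_
          by_cases hx : x ∈ S
          · have hmem : x + h • e ∈ Ω := hch.add_smul_mem hH hHr hx.1 hx.2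
              (hH.le.trans hh.1.le) (by linarith [hh.2])
            have hGg : G (ρ x) = g (ρ x) := indicator_of_mem (hρS x hx) g
            rw [indicator_of_mem hx, indicator_of_mem hmem, hch.add_smul, add_sub_cancel_right, hGg]
          · rw [indicator_of_notMem hx]; exact zero_le
      _ ≤ ∫⁻ h, ∫⁻ y in Ω, G (ρ y - h) * ‖u y - c‖ₑ := setLIntegral_le_lintegral _ _
      _ = ∫⁻ y in Ω, ∫⁻ h, G (ρ y - h) * ‖u y - c‖ₑ := by
          refine lintegral_lintegral_swap (Measurable.aemeasurable ?_)
          simp only [Function.uncurry_def]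
          fun_prop
      _ = ∫⁻ y in Ω, (∫⁻ t in Ioc 0 H, g t) * ‖u y - c‖ₑ := by
          refine lintegral_congr fun y => ?_
          rw [lintegral_mul_const _ (by fun_prop), lintegral_sub_left_eq_self G,
            lintegral_indicator measurableSet_Ioc]
      _ = _ := lintegral_const_mul _ (by fun_prop)
  have hmain : ENNReal.ofReal H * ∫⁻ x in S, g (ρ x) * ‖u x - c‖ₑ
      ≤ ENNReal.ofReal H * ((∫⁻ t in Ioc 0 H, g t) * bvSeminorm Ω u)
        + (∫⁻ t in Ioc 0 H, g t) * ∫⁻ x in Ω, ‖u x - c‖ₑ := by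
    calc ENNReal.ofReal H * ∫⁻ x in S, g (ρ x) * ‖u x - c‖ₑ
        = ∫⁻ _ in Ioc H (2 * H), ∫⁻ x in S, g (ρ x) * ‖u x - c‖ₑ := by
          rw [setLIntegral_const, hI, mul_comm]
      _ ≤ ∫⁻ h in Ioc H (2 * H), ((∫⁻ t in Ioc 0 H, g t) * bvSeminorm Ω u
            + ∫⁻ x in S, g (ρ x) * ‖u (x + h • e) - c‖ₑ) := by
          refine setLIntegral_mono' measurableSet_Ioc fun h hh => ?_
          refine le_trans ?_ (add_le_add_left
            (hch.lintegral_translate_sub_mul_le hH hHr hu hui hbv (hH.trans hh.1) hh.2 hg) _)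
          rw [← lintegral_add_left (by fun_prop)]
          refine lintegral_mono fun x => ?_
          rw [← mul_add]
          gcongr
          have : u x - c = (u (x + h • e) - c) - (u (x + h • e) - u x) := by ring
          rw [this]
          exact enorm_sub_le.trans_eq (add_comm _ _)
      _ = ENNReal.ofReal H * ((∫⁻ t in Ioc 0 H, g t) * bvSeminorm Ω u)
            + ∫⁻ h in Ioc H (2 * H), ∫⁻ x in S, g (ρ x) * ‖u (x + h • e) - c‖ₑ := by
          rw [lintegral_add_left measurable_const, setLIntegral_const, hI, mul_comm]
      _ ≤ _ := by gcongr
  rw [← ENNReal.mul_le_mul_iff_right hH0 ENNReal.ofReal_ne_top]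
  refine hmain.trans_eq ?_
  rw [mul_add, mul_add]
  congr 1
  rw [mul_left_comm, ENNReal.mul_div_cancel hH0 ENNReal.ofReal_ne_top]

end IsGraphChart

/-! ### The Hardy inequality on the whole domain -/

lemma ofReal_abs_mul (a b : ℝ) : ENNReal.ofReal (|a| * b) = ENNReal.ofReal b * ‖a‖ₑ := by
  rw [ENNReal.ofReal_mul (abs_nonneg a), mul_comm, Real.enorm_eq_ofReal_abs]

/-- The Hardy inequality near a boundary point, with a constant independent of `R` and `m`. -/
lemma IsGraphChart.setLIntegral_hardy_le {Ω : Set (EuclideanSpace ℝ (Fin d))}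
    {x₀ : EuclideanSpace ℝ (Fin d)} {r : ℝ} {e : EuclideanSpace ℝ (Fin d)}
    {ρ : EuclideanSpace ℝ (Fin d) → ℝ} {L : ℝ} (hch : IsGraphChart Ω x₀ r e ρ L) {H : ℝ}
    (hH : 0 < H) (hHr : 4 * H ≤ r) {β : ℝ} (hβ : 1 < β) {R : ℝ} (hHR : H < R)
    (hR : ∀ x ∈ Ω, bdryDist Ω x < R) {m : ℕ} (hm : 1 ≤ m) {u : EuclideanSpace ℝ (Fin d) → ℝ}
    (hu : Measurable u) (hui : Integrable u) (hbv : bvSeminorm Ω u ≠ ∞) (c : ℝ) :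
    ∫⁻ x in ball x₀ (H / L) ∩ Ω,
        ENNReal.ofReal (|u x - c| / bdryDist Ω x * logWeight m β (bdryDist Ω x / R))
      ≤ ENNReal.ofReal L * (ENNReal.ofReal (1 / (β - 1))
        * (bvSeminorm Ω u + (∫⁻ x in Ω, ‖u x - c‖ₑ) / ENNReal.ofReal H)) := by
  have hL : 0 < L := zero_lt_one.trans_le hch.one_le
  have hSm : MeasurableSet (ball x₀ (H / L) ∩ Ω) := (isOpen_ball.inter hch.isOpen).measurableSet
  have hg : Measurable fun t : ℝ => ENNReal.ofReal (logWeight m β (t / R) / t) := by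
    have := measurable_logWeight m β
    fun_prop
  have hρ := hch.continuous.measurable
  calc _ ≤ ∫⁻ x in ball x₀ (H / L) ∩ Ω, ENNReal.ofReal L
          * (ENNReal.ofReal (logWeight m β (ρ x / R) / ρ x) * ‖u x - c‖ₑ) := by
        refine setLIntegral_mono' hSm fun x hx => ?_
        have hρ0 := (hch.mem_iff_of_mem_ball hH hHr hx.1).1 hx.2
        have hρR := ((le_abs_self _).trans_lt (hch.abs_lt hx.1)).trans hHR
        have h1 := hch.bdryDist_le hH hHr hx.1 hx.2
        have h2 := hch.le_mul_bdryDist hH hHr hx.1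
        have hδ : 0 < bdryDist Ω x := pos_of_mul_pos_right (hρ0.trans_le h2) hL.le
        have hw := logWeight_mono (div_mem_Ioo_of_lt hδ (hR x hx.2)) (div_mem_Ioo_of_lt hρ0 hρR)
          (div_le_div_of_nonneg_right h1 (hρ0.trans hρR).le) m (zero_le_one.trans hβ.le)
        have hw0 := logWeight_nonneg (div_mem_Ioo_of_lt hρ0 hρR) m β
        rw [← mul_assoc, ← ENNReal.ofReal_mul hL.le, div_mul_eq_mul_div, mul_div_assoc,
          ofReal_abs_mul]
        gcongr
        rw [div_le_iff₀ hδ]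
        refine hw.trans ?_
        rw [mul_assoc, div_mul_eq_mul_div, mul_div_assoc', le_div_iff₀ hρ0]
        nlinarith
    _ = ENNReal.ofReal L * ∫⁻ x in ball x₀ (H / L) ∩ Ω,
          ENNReal.ofReal (logWeight m β (ρ x / R) / ρ x) * ‖u x - c‖ₑ := by
        refine lintegral_const_mul _ ?_
        exact (hg.comp hρ).mul (by fun_prop)
    _ ≤ _ := by
        gcongr
        refine (hch.lintegral_mul_sub_le hH hHr hu hui hbv hg c).trans ?_
        gcongr
        exact lintegral_logWeight_le hH hHR hm hβ

lemma setLIntegral_hardy_le_of_le_bdryDist {Ω V : Set (EuclideanSpace ℝ (Fin d))}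
    (hV : MeasurableSet V) (hVΩ : V ⊆ Ω) {s : ℝ} (hs : 0 < s) (hVs : ∀ x ∈ V, s ≤ bdryDist Ω x)
    {β : ℝ} (hβ : 0 ≤ β) {R : ℝ} (hR : ∀ x ∈ Ω, bdryDist Ω x < R) (m : ℕ)
    (u : EuclideanSpace ℝ (Fin d) → ℝ) (c : ℝ) :
    ∫⁻ x in V, ENNReal.ofReal (|u x - c| / bdryDist Ω x * logWeight m β (bdryDist Ω x / R))
      ≤ ENNReal.ofReal (1 / s) * ∫⁻ x in Ω, ‖u x - c‖ₑ := by
  rw [← lintegral_const_mul' _ _ ENNReal.ofReal_ne_top]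
  refine le_trans (setLIntegral_mono' hV fun x hx => ?_) (lintegral_mono_set hVΩ)
  have hδ := hs.trans_le (hVs x hx)
  have hmem := div_mem_Ioo_of_lt hδ (hR x (hVΩ hx))
  rw [div_mul_eq_mul_div, mul_div_assoc, ofReal_abs_mul]
  gcongr
  · exact logWeight_le_one hmem m hβ
  · exact hVs x hx

lemma IsBoundedLipschitzDomain.frontier_nonempty {n : ℕ}
    {Ω : Set (EuclideanSpace ℝ (Fin (n + 1)))} (hΩ : IsBoundedLipschitzDomain Ω) :
    (frontier Ω).Nonempty := by
  refine nonempty_frontier_iff.2 ⟨hΩ.isConnected.nonempty, fun h => ?_⟩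
  exact NormedSpace.unbounded_univ ℝ (EuclideanSpace ℝ (Fin (n + 1))) (h ▸ hΩ.isBounded)

lemma IsBoundedLipschitzDomain.bdryDist_pos {n : ℕ}
    {Ω : Set (EuclideanSpace ℝ (Fin (n + 1)))} (hΩ : IsBoundedLipschitzDomain Ω)
    {x : EuclideanSpace ℝ (Fin (n + 1))} (hx : x ∈ Ω) : 0 < bdryDist Ω x := by
  refine (isClosed_frontier.notMem_iff_infDist_pos hΩ.frontier_nonempty).1 fun h => ?_
  exact (hΩ.isOpen.frontier_eq ▸ h).2 hx

/-- The Hardy inequality for measurable representatives; the constant does not depend on `m`. -/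
theorem IsBoundedLipschitzDomain.exists_hardyIntegral_le {n : ℕ}
    {Ω : Set (EuclideanSpace ℝ (Fin (n + 1)))} (hΩ : IsBoundedLipschitzDomain Ω) {β : ℝ}
    (hβ : 1 < β) :
    ∃ C : ℝ≥0∞, C ≠ ∞ ∧ ∀ R : ℝ, (∀ x ∈ Ω, bdryDist Ω x < R) → ∀ m : ℕ, 1 ≤ m →
      ∀ u : EuclideanSpace ℝ (Fin (n + 1)) → ℝ, Measurable u → Integrable u →
        bvSeminorm Ω u ≠ ∞ → hardyIntegral Ω R m β u ≤ C * bvSeminorm Ω u := by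
  obtain ⟨z, hz⟩ := hΩ.isConnected.nonempty
  have hΩm := hΩ.isOpen.measurableSet
  obtain ⟨P, hP, hPoinc⟩ := hΩ.isPoincareSet.lintegral_enorm_sub_average_le
    (hΩ.isOpen.measure_pos volume ⟨z, hz⟩).ne'
  suffices key : ∃ C : ℝ≥0∞, C ≠ ∞ ∧ ∀ R : ℝ, (∀ x ∈ Ω, bdryDist Ω x < R) → ∀ m : ℕ, 1 ≤ m →
      ∀ u : EuclideanSpace ℝ (Fin (n + 1)) → ℝ, Measurable u → Integrable u →
        bvSeminorm Ω u ≠ ∞ → ∫⁻ x in closure Ω ∩ Ω, ENNReal.ofReal (|u x - ⨍ y in Ω, u y| /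
          bdryDist Ω x * logWeight m β (bdryDist Ω x / R)) ≤ C * bvSeminorm Ω u by
    rwa [inter_eq_self_of_subset_right subset_closure] at key
  refine hΩ.isBounded.isCompact_closure.induction_on
    (p := fun s => ∃ C : ℝ≥0∞, C ≠ ∞ ∧ ∀ R : ℝ, (∀ x ∈ Ω, bdryDist Ω x < R) → ∀ m : ℕ, 1 ≤ m →
      ∀ u : EuclideanSpace ℝ (Fin (n + 1)) → ℝ, Measurable u → Integrable u →
        bvSeminorm Ω u ≠ ∞ → ∫⁻ x in s ∩ Ω, ENNReal.ofReal (|u x - ⨍ y in Ω, u y| / bdryDist Ω x *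
          logWeight m β (bdryDist Ω x / R)) ≤ C * bvSeminorm Ω u) ?_ ?_ ?_ ?_
  · exact ⟨0, by simp, by simp⟩
  · rintro s t hst ⟨C, hC, h⟩
    exact ⟨C, hC, fun R hR m hm u hu hui hbv =>
      (lintegral_mono_set (inter_subset_inter_left _ hst)).trans (h R hR m hm u hu hui hbv)⟩
  · rintro s t ⟨C₁, hC₁, h₁⟩ ⟨C₂, hC₂, h₂⟩
    refine ⟨C₁ + C₂, by finiteness, fun R hR m hm u hu hui hbv => ?_⟩
    rw [union_inter_distrib_right, add_mul]
    exact (lintegral_union_le _ _ _).trans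
      (add_le_add (h₁ R hR m hm u hu hui hbv) (h₂ R hR m hm u hu hui hbv))
  · intro x hx
    by_cases hxΩ : x ∈ Ω
    · obtain ⟨s, hs, hball⟩ := Metric.isOpen_iff.1 hΩ.isOpen x hxΩ
      refine ⟨ball x (s / 2), mem_nhdsWithin_of_mem_nhds (ball_mem_nhds _ (half_pos hs)),
        ENNReal.ofReal (1 / (s / 2)) * P, by finiteness, fun R hR m hm u hu hui hbv => ?_⟩
      rw [mul_assoc]
      refine (setLIntegral_hardy_le_of_le_bdryDist (measurableSet_ball.inter hΩm) inter_subset_right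
        (half_pos hs) (fun y hy => ?_) (zero_le_one.trans hβ.le) hR m u _).trans
        (mul_le_mul_right (hPoinc u hu hui) _)
      refine (le_infDist hΩ.frontier_nonempty).2 fun w hw => ?_
      have hwΩ : w ∉ ball x s := fun h' => (hΩ.isOpen.frontier_eq ▸ hw).2 (hball h')
      have h1 : s ≤ dist w x := not_lt.1 hwΩ
      have h2 := mem_ball.1 hy.1
      have h3 := dist_triangle w y x
      rw [dist_comm w y] at h3
      linarith
    · have hfr : x ∈ frontier Ω := by rw [hΩ.isOpen.frontier_eq]; exact ⟨hx, hxΩ⟩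
      obtain ⟨r, e, ρ, L, hch⟩ := hΩ.exists_isGraphChart hfr
      have hL : 0 < L := zero_lt_one.trans_le hch.one_le
      have hδz := hΩ.bdryDist_pos hz
      -- `H ≤ δ(z) < R` for every admissible `R`
      set H := min (r / 4) (bdryDist Ω z)
      have hH : 0 < H := lt_min (div_pos hch.r_pos (by norm_num)) hδz
      have hHr : 4 * H ≤ r := by have := min_le_left (r / 4) (bdryDist Ω z); linarith
      have hH0 : ENNReal.ofReal H ≠ 0 := by simpa using hH
      have hPH := ENNReal.div_ne_top hP hH0
      refine ⟨ball x (H / L), mem_nhdsWithin_of_mem_nhds (ball_mem_nhds _ (div_pos hH hL)),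
        ENNReal.ofReal L * (ENNReal.ofReal (1 / (β - 1)) * (1 + P / ENNReal.ofReal H)),
        by finiteness, fun R hR m hm u hu hui hbv => ?_⟩
      refine (hch.setLIntegral_hardy_le hH hHr hβ ((min_le_right _ _).trans_lt (hR z hz)) hR hm hu
        hui hbv _).trans ?_
      rw [mul_assoc, mul_assoc, add_mul, one_mul, ← ENNReal.mul_div_right_comm]
      gcongr
      exact hPoinc u hu hui

/-! ### Reduction to measurable representatives -/

lemma bvSeminorm_congr_ae {Ω : Set (EuclideanSpace ℝ (Fin d))}
    {u v : EuclideanSpace ℝ (Fin d) → ℝ} (h : u =ᵐ[volume.restrict Ω] v) :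
    bvSeminorm Ω u = bvSeminorm Ω v := by
  unfold bvSeminorm
  refine iSup_congr fun φ => iSup_congr fun _ => ?_
  congr 1
  exact integral_congr_ae (h.mono fun x hx => by simp only [hx])

lemma hardyIntegral_congr_ae {Ω : Set (EuclideanSpace ℝ (Fin d))}
    {u v : EuclideanSpace ℝ (Fin d) → ℝ} (h : u =ᵐ[volume.restrict Ω] v) (R : ℝ) (m : ℕ) (β : ℝ) :
    hardyIntegral Ω R m β u = hardyIntegral Ω R m β v := by
  unfold hardyIntegral
  rw [average_congr h]
  exact lintegral_congr_ae (h.mono fun x hx => by simp only [hx])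

lemma exists_measurable_integrable_ae_eq {Ω : Set (EuclideanSpace ℝ (Fin d))}
    (hΩ : MeasurableSet Ω) {u : EuclideanSpace ℝ (Fin d) → ℝ} (hu : IntegrableOn u Ω) :
    ∃ v : EuclideanSpace ℝ (Fin d) → ℝ, Measurable v ∧ Integrable v ∧
      u =ᵐ[volume.restrict Ω] v := by
  have hm := hu.aestronglyMeasurable
  have h1 : u =ᵐ[volume.restrict Ω] hm.mk u := hm.ae_eq_mk
  refine ⟨Ω.indicator (hm.mk u), hm.stronglyMeasurable_mk.measurable.indicator hΩ, ?_, ?_⟩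
  · rw [integrable_indicator_iff hΩ]
    exact Integrable.congr hu h1
  · filter_upwards [h1, ae_restrict_mem hΩ] with x hx hxΩ
    rw [indicator_of_mem hxΩ, hx]

/-! ### Divergence of the weighted integrals -/

lemma bvSeminorm_lt_top_of_contDiff (Ω : Set (EuclideanSpace ℝ (Fin d)))
    {u : EuclideanSpace ℝ (Fin d) → ℝ} (hu : ContDiff ℝ 1 u) (hc : HasCompactSupport u) :
    bvSeminorm Ω u < ∞ := by
  have hdu : ∀ i, Integrable fun x => fderiv ℝ u x (EuclideanSpace.single i 1) := fun i =>
    ((hu.continuous_fderiv one_ne_zero).clm_apply continuous_const).integrable_of_hasCompactSupport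
      (hc.fderiv_apply ℝ _)
  refine lt_of_le_of_lt (iSup₂_le fun φ hφ => ?_) (ENNReal.ofReal_lt_top
    (r := ∑ i, ∫ x, ‖fderiv ℝ u x (EuclideanSpace.single i 1)‖))
  obtain ⟨hφ1, hφc, hφΩ, hφb⟩ := hφ
  have hφ0 : ∀ x, ‖φ x‖ ≤ 1 := fun x => by
    by_cases hx : x ∈ Ω
    · exact hφb x hx
    · rw [image_eq_zero_of_notMem_tsupport fun h => hx (hφΩ h)]; simp
  have hcomp : ∀ i, ContDiff ℝ 1 fun x => φ x i := contDiff_euclidean.1 hφ1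
  have hcompc : ∀ i, HasCompactSupport fun x => φ x i := fun i =>
    hφc.comp_left (g := fun y : EuclideanSpace ℝ (Fin d) => y i) rfl
  have hd : ∀ i x, (fderiv ℝ φ x (EuclideanSpace.single i 1)) i
      = fderiv ℝ (fun x => φ x i) x (EuclideanSpace.single i 1) := by
    intro i x
    have h1 := (EuclideanSpace.proj i : EuclideanSpace ℝ (Fin d) →L[ℝ] ℝ).hasFDerivAt.comp x
      (hφ1.differentiable one_ne_zero x).hasFDerivAt
    have h2 : HasFDerivAt (fun x => φ x i) _ x := h1
    rw [h2.fderiv]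
    rfl
  have hint : ∀ i, Integrable fun x =>
      u x * fderiv ℝ (fun x => φ x i) x (EuclideanSpace.single i 1) := fun i =>
    (hu.continuous.mul (((hcomp i).continuous_fderiv one_ne_zero).clm_apply
      continuous_const)).integrable_of_hasCompactSupport hc.mul_right
  have hint' : ∀ i, Integrable fun x =>
      fderiv ℝ u x (EuclideanSpace.single i 1) * φ x i := fun i =>
    (((hu.continuous_fderiv one_ne_zero).clm_apply continuous_const).mul
      (hcomp i).continuous).integrable_of_hasCompactSupport (hcompc i).mul_left
  have heq : ∫ x in Ω, u x * divergence φ x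
      = ∑ i, -∫ x, fderiv ℝ u x (EuclideanSpace.single i 1) * φ x i := by
    rw [setIntegral_eq_integral_of_forall_compl_eq_zero]
    · simp_rw [divergence, hd, Finset.mul_sum]
      rw [integral_finsetSum _ fun i _ => hint i]
      refine Finset.sum_congr rfl fun i _ => ?_
      refine integral_mul_fderiv_eq_neg_fderiv_mul_of_integrable (hint' i) (hint i) ?_
        (fun x _ => hu.differentiable one_ne_zero x)
        (fun x _ => (hcomp i).differentiable one_ne_zero x)
      exact (hu.continuous.mul (hcomp i).continuous).integrable_of_hasCompactSupport hc.mul_right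
    · intro x hx
      have : fderiv ℝ φ x = 0 := fderiv_of_notMem_tsupport ℝ fun h => hx (hφΩ h)
      simp [divergence, this]
  rw [heq]
  refine ENNReal.ofReal_le_ofReal (Finset.sum_le_sum fun i _ => ?_)
  refine (neg_le_abs _).trans ?_
  rw [← Real.norm_eq_abs]
  refine (norm_integral_le_integral_norm _).trans ?_
  refine integral_mono (hint' i).norm (hdu i).norm fun x => ?_
  simp only [norm_mul]
  exact mul_le_of_le_one_right (norm_nonneg _) ((PiLp.norm_apply_le (φ x) i).trans (hφ0 x))

/-- The volume of the layers `{ρ ∈ A}` near a boundary point is at least a multiple of `|A|`; here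
in integrated form. Fubini's theorem in the vertical direction is replaced by an average over
vertical translations. -/
lemma IsGraphChart.exists_le_lintegral_comp {Ω : Set (EuclideanSpace ℝ (Fin d))}
    {x₀ : EuclideanSpace ℝ (Fin d)} {r : ℝ} {e : EuclideanSpace ℝ (Fin d)}
    {ρ : EuclideanSpace ℝ (Fin d) → ℝ} {L : ℝ} (hch : IsGraphChart Ω x₀ r e ρ L) {H : ℝ}
    (hH : 0 < H) (hHr : 4 * H ≤ r) :
    ∃ b : ℝ, 0 < b ∧ b ≤ H ∧ ∃ κ : ℝ≥0∞, κ ≠ 0 ∧ ∀ g : ℝ → ℝ≥0∞, Measurable g →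
      κ * ∫⁻ t in Ioc 0 b, g t ≤ ∫⁻ x in ball x₀ (H / L) ∩ Ω, g (ρ x) := by
  have hL1 := hch.one_le
  have hL : 0 < L := zero_lt_one.trans_le hL1
  set b := H / (L * (L + 2))
  have hb : 0 < b := by positivity
  have hbH : (L + 2) * b = H / L := by simp only [b]; field_simp
  have hHL : H / L ≤ H := div_le_self hH.le hL1
  set B := ball x₀ b
  set I := Icc (-((L + 1) * b)) ((L + 1) * b)
  have hI : volume I = ENNReal.ofReal (2 * ((L + 1) * b)) := by
    rw [Real.volume_Icc]; congr 1; ring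
  have hI0 : volume I ≠ 0 := by rw [hI]; simpa using by positivity
  have hIt : volume I ≠ ∞ := by rw [hI]; exact ENNReal.ofReal_ne_top
  have hρB : ∀ x ∈ B, |ρ x| ≤ L * b := by
    intro x hx
    have h1 : x ∈ ball x₀ (L * b / L) := by rwa [mul_div_cancel_left₀ _ hL.ne']
    exact (hch.abs_lt h1).le
  refine ⟨b, hb, by nlinarith, volume B / volume I,
    ENNReal.div_ne_zero.2 ⟨(measure_ball_pos volume x₀ hb).ne', hIt⟩, fun g hg => ?_⟩
  set G : ℝ → ℝ≥0∞ := (Ioc 0 b).indicator g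
  have hG : Measurable G := hg.indicator measurableSet_Ioc
  have hρ := hch.continuous.measurable
  set S := ball x₀ (H / L) ∩ Ω
  have hSm : MeasurableSet S := (isOpen_ball.inter hch.isOpen).measurableSet
  have hBm : MeasurableSet B := measurableSet_ball
  have hle : volume B * ∫⁻ t in Ioc 0 b, g t ≤ volume I * ∫⁻ x in S, g (ρ x) := by
    calc volume B * ∫⁻ t in Ioc 0 b, g t = ∫⁻ x in B, ∫⁻ s, G (ρ x - s) := by
          simp_rw [lintegral_sub_left_eq_self G]
          rw [setLIntegral_const, lintegral_indicator measurableSet_Ioc, mul_comm]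
      _ ≤ ∫⁻ x in B, ∫⁻ s in I, G (ρ x - s) := by
          refine setLIntegral_mono' hBm fun x hx => ?_
          rw [← lintegral_indicator measurableSet_Icc]
          refine lintegral_mono fun s => ?_
          by_cases hs : ρ x - s ∈ Ioc 0 b
          · have h1 := abs_le.1 (hρB x hx)
            have h2 : s ∈ I := ⟨by linarith [hs.2, h1.1], by linarith [hs.1, h1.2]⟩
            rw [indicator_of_mem h2]
          · have : G (ρ x - s) = 0 := indicator_of_notMem hs g
            rw [this]; exact zero_le
      _ = ∫⁻ s in I, ∫⁻ x in B, G (ρ x - s) := by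
          refine lintegral_lintegral_swap (Measurable.aemeasurable ?_)
          simp only [Function.uncurry_def]
          fun_prop
      _ ≤ ∫⁻ s in I, ∫⁻ x in S, g (ρ x) := by
          refine setLIntegral_mono' measurableSet_Icc fun s hs => ?_
          rw [← lintegral_indicator hSm, ← lintegral_indicator hBm,
            ← lintegral_add_right_eq_self (S.indicator _) ((-s) • e)]
          refine lintegral_mono fun x => ?_
          by_cases hx : x ∈ B ∧ ρ x - s ∈ Ioc 0 b
          · have hmem : x + (-s) • e ∈ ball x₀ (H / L) := by
              have h1 := mem_ball.1 hx.1
              have h2 : |s| ≤ (L + 1) * b := abs_le.2 hs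
              rw [mem_ball]
              calc dist (x + (-s) • e) x₀ ≤ dist (x + (-s) • e) x + dist x x₀ := dist_triangle _ _ _
                _ = |s| + dist x x₀ := by
                    rw [dist_eq_norm, add_sub_cancel_left, norm_smul, hch.norm_e, mul_one, norm_neg,
                      Real.norm_eq_abs]
                _ < H / L := by rw [← hbH]; linarith
            have hmemS : x + (-s) • e ∈ S := by
              refine ⟨hmem, (hch.mem_iff_of_mem_ball hH hHr hmem).2 ?_⟩
              rw [hch.add_smul]
              linarith [hx.2.1]
            have hGg : G (ρ x - s) = g (ρ x - s) := indicator_of_mem hx.2 g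
            rw [indicator_of_mem hx.1, indicator_of_mem hmemS, hch.add_smul, hGg, sub_eq_add_neg]
          · have : B.indicator (fun x => G (ρ x - s)) x = 0 := by
              by_cases hxB : x ∈ B
              · rw [indicator_of_mem hxB]
                exact indicator_of_notMem (fun h' => hx ⟨hxB, h'⟩) g
              · exact indicator_of_notMem hxB _
            rw [this]; exact zero_le
      _ = volume I * ∫⁻ x in S, g (ρ x) := by rw [setLIntegral_const, mul_comm]
  rw [← ENNReal.mul_div_right_comm]
  exact ENNReal.div_le_of_le_mul' hle

/-- A bump function `u` has `|u - (u)_Ω|` constant and positive near the boundary, so its weighted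
integrals dominate one-dimensional integrals of the weights. -/
theorem IsBoundedLipschitzDomain.exists_memBV_le_hardyIntegral {n : ℕ}
    {Ω : Set (EuclideanSpace ℝ (Fin (n + 1)))} (hΩ : IsBoundedLipschitzDomain Ω) {R : ℝ}
    (hR0 : 0 < R) (hR : ∀ x ∈ Ω, bdryDist Ω x < R) :
    ∃ u, MemBV Ω u ∧ ∃ b R' : ℝ, 0 < b ∧ b < R' ∧ ∃ κ : ℝ≥0∞, κ ≠ 0 ∧
      ∀ (m : ℕ) (β : ℝ), 0 ≤ β →
        κ * ∫⁻ t in Ioc 0 b, ENNReal.ofReal (logWeight m β (t / R') / t)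
          ≤ hardyIntegral Ω R m β u := by
  obtain ⟨z, hz⟩ := hΩ.isConnected.nonempty
  obtain ⟨s, hs, hball⟩ := Metric.isOpen_iff.1 hΩ.isOpen z hz
  let f : ContDiffBump z := ⟨s / 4, s / 2, by positivity, by linarith⟩
  have hfΩ : tsupport f ⊆ Ω := by
    rw [f.tsupport_eq]
    exact (closedBall_subset_ball (by simp only [f]; linarith)).trans hball
  have hfi : Integrable f := f.continuous.integrable_of_hasCompactSupport f.hasCompactSupport
  have hΩ0 : 0 < volume.real Ω := ENNReal.toReal_pos (hΩ.isOpen.measure_pos volume ⟨z, hz⟩).ne'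
    hΩ.isBounded.measure_lt_top.ne
  have ha : 0 < ⨍ y in Ω, f y := by
    rw [setAverage_eq, setIntegral_eq_integral_of_forall_compl_eq_zero fun x hx =>
      image_eq_zero_of_notMem_tsupport fun h => hx (hfΩ h), smul_eq_mul]
    exact mul_pos (inv_pos.2 hΩ0) f.integral_pos
  obtain ⟨x₀, hx₀⟩ := hΩ.frontier_nonempty
  obtain ⟨r, e, ρ, L, hch⟩ := hΩ.exists_isGraphChart hx₀
  have hL : 0 < L := zero_lt_one.trans_le hch.one_le
  have hx₀f : x₀ ∈ (tsupport f)ᶜ := fun h => (hΩ.isOpen.frontier_eq ▸ hx₀).2 (hfΩ h)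
  obtain ⟨s', hs', hball'⟩ :=
    Metric.isOpen_iff.1 (isClosed_tsupport f).isOpen_compl x₀ hx₀f
  set H := min (r / 4) (min s' (R / 2))
  have hH : 0 < H := lt_min (div_pos hch.r_pos (by norm_num)) (lt_min hs' (half_pos hR0))
  have hHr : 4 * H ≤ r := by have := min_le_left (r / 4) (min s' (R / 2)); linarith
  have hHs : H ≤ s' := (min_le_right _ _).trans (min_le_left _ _)
  have hHR : H < R := ((min_le_right _ _).trans (min_le_right _ _)).trans_lt (half_lt_self hR0)
  have hRL : R ≤ L * R := le_mul_of_one_le_left hR0.le hch.one_le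
  obtain ⟨b, hb, hbH, κ, hκ, hκb⟩ := hch.exists_le_lintegral_comp hH hHr
  set a := ⨍ y in Ω, f y
  have ha' : ENNReal.ofReal a ≠ 0 := by simpa using ha
  refine ⟨f, ⟨hfi.integrableOn, bvSeminorm_lt_top_of_contDiff Ω f.contDiff f.hasCompactSupport⟩,
    b, L * R, hb, by linarith, ENNReal.ofReal a * κ, mul_ne_zero ha' hκ, fun m β hβ => ?_⟩
  have hSm : MeasurableSet (ball x₀ (H / L) ∩ Ω) := (isOpen_ball.inter hΩ.isOpen).measurableSet
  have hg : Measurable fun t : ℝ => ENNReal.ofReal (logWeight m β (t / (L * R)) / t) := by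
    have := measurable_logWeight m β
    fun_prop
  rw [mul_assoc]
  refine (mul_le_mul_right (hκb _ hg) _).trans ?_
  rw [← lintegral_const_mul _ (by exact hg.comp hch.continuous.measurable)]
  refine le_trans (setLIntegral_mono' hSm fun x hx => ?_) (lintegral_mono_set inter_subset_right)
  have hρ0 := (hch.mem_iff_of_mem_ball hH hHr hx.1).1 hx.2
  have h1 := hch.bdryDist_le hH hHr hx.1 hx.2
  have h2 := hch.le_mul_bdryDist hH hHr hx.1
  have hδ := hΩ.bdryDist_pos hx.2
  have hρR : ρ x < L * R := h2.trans_lt (mul_lt_mul_of_pos_left (hR x hx.2) hL)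
  have hfx : f x = 0 := image_eq_zero_of_notMem_tsupport
    (hball' (ball_subset_ball hHs (hch.ball_subset hH.le hx.1)))
  have hle : ρ x / (L * R) ≤ bdryDist Ω x / R := by
    rw [div_le_div_iff₀ (by positivity) hR0]
    nlinarith
  have hw := logWeight_mono (div_mem_Ioo_of_lt hρ0 hρR) (div_mem_Ioo_of_lt hδ (hR x hx.2)) hle m hβ
  have hw0 := logWeight_nonneg (div_mem_Ioo_of_lt hρ0 hρR) m β
  rw [← ENNReal.ofReal_mul ha.le, hfx, zero_sub, abs_neg, abs_of_pos ha, div_mul_eq_mul_div,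
    mul_div_assoc]
  refine ENNReal.ofReal_le_ofReal (mul_le_mul_of_nonneg_left ?_ ha.le)
  exact div_le_div₀ (hw0.trans hw) hw hδ h1

end BVHardy

open BVHardy in
theorem corollary1p2 (n : ℕ) (Ω : Set (EuclideanSpace ℝ (Fin (n + 1))))
    (hΩ : BVHardy.IsBoundedLipschitzDomain Ω) :
    -- the inequality for a single `m ≥ 1`
    (∀ β : ℝ, 1 < β → ∃ C : ℝ, 0 < C ∧
      ∀ R : ℝ, 0 < R → (∀ x ∈ Ω, BVHardy.bdryDist Ω x < R) →
      ∀ m : ℕ, 1 ≤ m → ∀ u : EuclideanSpace ℝ (Fin (n + 1)) → ℝ, BVHardy.MemBV Ω u →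
        BVHardy.hardyIntegral Ω R m β u ≤ ENNReal.ofReal (C * 2 ^ m) * BVHardy.bvSeminorm Ω u) ∧
    -- the series inequality; the summation index is `m + 2`, for `m = 0, 1, 2, …`
    (∀ β : ℝ, 1 < β → ∃ C : ℝ, 0 < C ∧
      ∀ R : ℝ, 0 < R → (∀ x ∈ Ω, BVHardy.bdryDist Ω x < R) →
      ∀ α : ℝ, 0 < α → α < 1 / 2 →
      ∀ u : EuclideanSpace ℝ (Fin (n + 1)) → ℝ, BVHardy.MemBV Ω u →
        ∑' m : ℕ, ENNReal.ofReal (α ^ (m + 2)) * BVHardy.hardyIntegral Ω R (m + 2) β u ≤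
          ENNReal.ofReal (C * (4 * α ^ 2 / (1 - 2 * α))) * BVHardy.bvSeminorm Ω u) ∧
    -- failure of the series inequality if `α ≥ 1` or `0 < β ≤ 1`: its left-hand side is infinite
    -- for some `u ∈ BV(Ω)`
    (∀ R : ℝ, 0 < R → (∀ x ∈ Ω, BVHardy.bdryDist Ω x < R) →
      ∀ α : ℝ, 0 < α → ∀ β : ℝ, 0 < β → (1 ≤ α ∨ β ≤ 1) →
      ∃ u : EuclideanSpace ℝ (Fin (n + 1)) → ℝ, BVHardy.MemBV Ω u ∧
        ∑' m : ℕ, ENNReal.ofReal (α ^ (m + 2)) * BVHardy.hardyIntegral Ω R (m + 2) β u = ∞) ∧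
    -- failure of the inequality for a single `m ≥ 1` if `0 < β ≤ 1`, in the same sense
    (∀ R : ℝ, 0 < R → (∀ x ∈ Ω, BVHardy.bdryDist Ω x < R) →
      ∀ β : ℝ, 0 < β → β ≤ 1 → ∀ m : ℕ, 1 ≤ m →
      ∃ u : EuclideanSpace ℝ (Fin (n + 1)) → ℝ, BVHardy.MemBV Ω u ∧
        BVHardy.hardyIntegral Ω R m β u = ∞) := by
  have single : ∀ β : ℝ, 1 < β → ∃ C : ℝ, 0 < C ∧
      ∀ R : ℝ, 0 < R → (∀ x ∈ Ω, bdryDist Ω x < R) →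
      ∀ m : ℕ, 1 ≤ m → ∀ u : EuclideanSpace ℝ (Fin (n + 1)) → ℝ, MemBV Ω u →
        hardyIntegral Ω R m β u ≤ ENNReal.ofReal (C * 2 ^ m) * bvSeminorm Ω u := by
    intro β hβ
    obtain ⟨C, hC, h⟩ := hΩ.exists_hardyIntegral_le hβ
    refine ⟨C.toReal + 1, by positivity, fun R _ hR m hm u hu => ?_⟩
    obtain ⟨v, hv, hvi, huv⟩ := exists_measurable_integrable_ae_eq hΩ.isOpen.measurableSet hu.1
    rw [hardyIntegral_congr_ae huv, bvSeminorm_congr_ae huv]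
    refine (h R hR m hm v hv hvi (bvSeminorm_congr_ae huv ▸ hu.2.ne)).trans ?_
    gcongr
    refine ENNReal.le_ofReal_iff_toReal_le hC (by positivity) |>.2 ?_
    have : (1 : ℝ) ≤ 2 ^ m := one_le_pow₀ one_le_two
    nlinarith [ENNReal.toReal_nonneg (a := C)]
  refine ⟨single, fun β hβ => ?_, fun R hR0 hR α hα β hβ h => ?_, fun R hR0 hR β hβ hβ1 m hm => ?_⟩
  · obtain ⟨C, hC, h⟩ := single β hβ
    refine ⟨C, hC, fun R hR0 hR α hα hα2 u hu => ?_⟩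
    have hsum : HasSum (fun m : ℕ => C * (2 * α) ^ 2 * (2 * α) ^ m)
        (C * (4 * α ^ 2 / (1 - 2 * α))) := by
      have heq : C * (4 * α ^ 2 / (1 - 2 * α)) = C * (2 * α) ^ 2 * (1 - 2 * α)⁻¹ := by
        rw [div_eq_mul_inv]; ring
      rw [heq]
      exact (hasSum_geometric_of_lt_one (by positivity) (by linarith)).mul_left _
    calc ∑' m : ℕ, ENNReal.ofReal (α ^ (m + 2)) * hardyIntegral Ω R (m + 2) β u
        ≤ ∑' m : ℕ, ENNReal.ofReal (C * (2 * α) ^ 2 * (2 * α) ^ m) * bvSeminorm Ω u := by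
          refine ENNReal.tsum_le_tsum fun m => ?_
          refine (mul_le_mul_right (h R hR0 hR (m + 2) (by omega) u hu) _).trans_eq ?_
          rw [← mul_assoc, ← ENNReal.ofReal_mul (by positivity)]
          congr 2
          ring
      _ = _ := by
          rw [ENNReal.tsum_mul_right, ← ENNReal.ofReal_tsum_of_nonneg (fun m => by positivity)
            hsum.summable, hsum.tsum_eq]
  · obtain ⟨u, hu, b, R', hb, hbR, κ, hκ, hle⟩ := hΩ.exists_memBV_le_hardyIntegral hR0 hR
    refine ⟨u, hu, ?_⟩
    rcases h with hα1 | hβ1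
    · obtain ⟨c, hc, hcle⟩ := exists_le_lintegral_logWeight hb hbR β
      rw [eq_top_iff, ← ENNReal.tsum_const_eq_top_of_ne_zero (α := ℕ) (mul_ne_zero hκ hc)]
      refine ENNReal.tsum_le_tsum fun m => ?_
      have h1 : 1 ≤ ENNReal.ofReal (α ^ (m + 2)) := by
        rw [ENNReal.one_le_ofReal]; exact one_le_pow₀ hα1
      refine (mul_le_mul_right (hcle (m + 2) (by omega)) κ).trans ((hle (m + 2) β hβ.le).trans ?_)
      exact le_mul_of_one_le_left zero_le h1
    · refine ENNReal.tsum_eq_top_of_eq_top ⟨0, ?_⟩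
      have h1 := hle (0 + 2) β hβ.le
      rw [lintegral_logWeight_eq_top hb hbR (by omega) hβ1, ENNReal.mul_top hκ, top_le_iff] at h1
      rw [h1, ENNReal.mul_top]
      simpa using by positivity
  · obtain ⟨u, hu, b, R', hb, hbR, κ, hκ, hle⟩ := hΩ.exists_memBV_le_hardyIntegral hR0 hR
    refine ⟨u, hu, ?_⟩
    have h1 := hle m β hβ.le
    rwa [lintegral_logWeight_eq_top hb hbR hm hβ1, ENNReal.mul_top hκ, top_le_iff] at h1
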